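/- For a finite simple undirected graph $G=(V,E)$ with $n=|V|$ vertices and edge weights $\mathbf w\in\mathbb R_{\ge 0}^{E}$, let $\mathrm{dist}_{\mathbf w}(u,v)$ be the smallest total weight of a path from $u$ to $v$ in $G$ ($+\infty$ if there is no path). The graph is public and the weights are private: two weight vectors $\mathbf w,\mathbf w'$ are neighbors if $\|\mathbf w-\mathbf w'\|_1\le 1$. A randomized algorithm $\mathcal M$ (a map, measurable in $\mathbf w$, from weight vectors to probability distributions on outputs) is $(\epsilon,\delta)$-DP if $\Pr[\mathcal M(\mathbf w)\in T]\le e^{\epsilon}\Pr[\mathcal M(\mathbf w')\in T]+\delta$ for all neighbors $\mathbf w,\mathbf w'$ and all measurable sets $T$ of outputs. For $S\subseteq V$, an algorithm for the $S$-pair shortest path distances problem outputs estimates $\widetilde{\mathrm{dist}}(u,v)\in[0,\infty]$ for all $u,v\in S$; the output is $(\gamma,\alpha)$-accurate if $\mathrm{dist}_{\mathbf w}(u,v)-\alpha\le\widetilde{\mathrm{dist}}(u,v)\le\gamma\cdot\mathrm{dist}_{\mathbf w}(u,v)+\alpha$ for all $u,v\in S$. **Theorem.** There are absolute constants $C_1,C_2>0$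 such that for every finite graph $G=(V,E)$ with $n$ vertices, every $S\subseteq V$, every integer $k\ge 1$ and all $\epsilon,\delta\in(0,1)$ there is an $(\epsilon,\delta)$-DP algorithm for the $S$-pair shortest path distances problem such that, for every weight vector $\mathbf w\in\mathbb R_{\ge 0}^{E}$, with probability at least $1-C_2/n$ its output is $$\left(2k-1,\; C_1\cdot\frac{k^{3/2}\,(\log n)^{3/2}\,\sqrt{|S|^{1+1/k}\,\log(2/\delta)}}{\epsilon}\right)\text{-accurate.}$$ (For $\delta\le 1/2$, $\log(2/\delta)\le 2\log(1/\delta)$, so the additive error is then $O\big(k^{3/2}\log^{3/2}n\,\sqrt{|S|^{1+1/k}\log(1/\delta)}/\epsilon\big)$.) -/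

import Mathlib

open MeasureTheory ProbabilityTheory
open scoped NNReal ENNReal

namespace PrivateDist

/-- The total weight of a walk, for nonnegative edge weights `w` on the edges of `G`. -/
def walkWeight {V : Type*} {G : SimpleGraph V} (w : G.edgeSet → ℝ≥0) :
    {u v : V} → G.Walk u v → ℝ≥0
  | _, _, SimpleGraph.Walk.nil => 0
  | _, _, SimpleGraph.Walk.cons (u := a) (v := b) h p =>
      w ⟨s(a, b), h⟩ + walkWeight w p

/-- The shortest-path distance between `u` and `v` in the weighted graph `(G, w)`: the smallest
weight of a walk from `u` to `v` (as weights are nonnegative, repeated vertices never help, so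
this is the smallest weight of a path).  It is `∞` if no path joins `u` and `v`. -/
noncomputable def wdist {V : Type*} {G : SimpleGraph V} (w : G.edgeSet → ℝ≥0) (u v : V) : ℝ≥0∞ :=
  ⨅ p : G.Walk u v, (walkWeight w p : ℝ≥0∞)

/-- Two weight vectors are neighbors if their `ℓ₁` distance is at most `1`. -/
def Neighboring {E : Type*} [Fintype E] (w w' : E → ℝ≥0) : Prop :=
  ∑ e, |(w e : ℝ) - (w' e : ℝ)| ≤ 1

/-- `(ε, δ)`-differential privacy of a randomized algorithm, given as a kernel from weight
vectors to outputs. -/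
def IsDP {E Ω : Type*} [Fintype E] [MeasurableSpace Ω] (ε δ : ℝ)
    (M : Kernel (E → ℝ≥0) Ω) : Prop :=
  ∀ w w' : E → ℝ≥0, Neighboring w w' → ∀ T : Set Ω, MeasurableSet T →
    M w T ≤ ENNReal.ofReal (Real.exp ε) * M w' T + ENNReal.ofReal δ

/-- The estimates `est` of the distances between pairs of `S` are `(γ, α)`-accurate:
`dist(u, v) - α ≤ est(u, v) ≤ γ * dist(u, v) + α` for all `u, v ∈ S`, where distances are taken in
the whole graph.  The lower bound is written without subtraction. -/
def IsAccurate {V : Type*} {G : SimpleGraph V} (w : G.edgeSet → ℝ≥0) (S : Finset V)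
    (γ α : ℝ) (est : S → S → ℝ≥0∞) : Prop :=
  ∀ u v : S, wdist w (u : V) (v : V) ≤ est u v + ENNReal.ofReal α ∧
    est u v ≤ ENNReal.ofReal γ * wdist w (u : V) (v : V) + ENNReal.ofReal α

end PrivateDist

/-! The algorithm is a private greedy spanner on the terminals. A pair joined by fewer than `2 * k`
hops of recorded links is covered. Each step picks an uncovered pair of nearly minimal distance,
together with an approximate value of that distance, by one exponential mechanism. The estimates are
the cheapest chains of fewer than `2 * k` recorded links.

Size: a new link joins an uncovered pair, so the link graph has no cycle of length at most `2 * k`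
(`Good.length_lt_of_isCycle`). The Moore-type bound `ncard_edgeSet_le` then allows at most `|S| ^ (1
+ 1/k)` links, so slightly more steps than that cover every linked pair
(`release_not_isAccurate_le`).

Accuracy: when a pair first becomes covered, every link recorded so far was chosen while that pair
was still a candidate, so none is much heavier than its distance (`Good.exists_cheap_chain`). At
most `2 * k - 1` hops give the stretch and multiply the selection error by the same factor.

Privacy: each distance changes by at most `1` between neighbors (`abs_realDist_sub_le`), so a
selection has a likelihood ratio close to `1` (`select_le`), however many pairs compete. The `m`
adaptive selections compose through Hölder moment bounds (`MomentClose.bind`), and the privacy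
parameter grows like `√m`. The resulting error is of order `k * log n * √(m * log (2/δ)) / ε`, which
the stated bound dominates. -/

namespace PrivateDist

/-! ### Moment bounds for likelihood ratios, and advanced composition. -/

section Moment

variable {X Y : Type*}

/-- The expectation of a nonnegative function under a discrete distribution. -/
noncomputable def mean (P : PMF X) (g : X → ℝ≥0∞) : ℝ≥0∞ := ∑' x, P x * g x

lemma mean_mono (P : PMF X) {f g : X → ℝ≥0∞} (h : ∀ x, f x ≤ g x) : mean P f ≤ mean P g :=
  ENNReal.tsum_le_tsum fun x => mul_le_mul_right (h x) _

lemma mean_const_mul (P : PMF X) (c : ℝ≥0∞) (g : X → ℝ≥0∞) :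
    mean P (fun x => c * g x) = c * mean P g := by
  simp only [mean, ← ENNReal.tsum_mul_left]
  exact tsum_congr fun x => by ring

lemma mean_pure (x : X) (g : X → ℝ≥0∞) : mean (PMF.pure x) g = g x := by
  rw [mean, tsum_eq_single x]
  · simp
  · intro y hy
    simp [PMF.pure_apply, hy]

lemma mean_bind (P : PMF X) (f : X → PMF Y) (g : Y → ℝ≥0∞) :
    mean (P.bind f) g = mean P (fun x => mean (f x) g) := by
  simp only [mean, PMF.bind_apply, ← ENNReal.tsum_mul_right, ← ENNReal.tsum_mul_left]
  rw [ENNReal.tsum_comm]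
  exact tsum_congr fun x => tsum_congr fun y => by ring

lemma mean_indicator (P : PMF X) (T : Set X) :
    mean P (T.indicator 1) = P.toOuterMeasure T := by
  rw [PMF.toOuterMeasure_apply]
  refine tsum_congr fun x => ?_
  by_cases hx : x ∈ T <;> simp [hx]

/-- Expectations under `P` are controlled by `q`-th moments under `P'`. -/
def MomentClose (q : ℝ) (a : ℝ≥0∞) (P P' : PMF X) : Prop :=
  ∀ g : X → ℝ≥0∞, mean P g ≤ a * mean P' (fun x => g x ^ q) ^ (1 / q)

lemma momentClose_self_pure {q : ℝ} (hq : 1 ≤ q) {a : ℝ≥0∞} (ha : 1 ≤ a) (x : X) :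
    MomentClose q a (PMF.pure x) (PMF.pure x) := by
  intro g
  rw [mean_pure, mean_pure, ← ENNReal.rpow_mul, mul_one_div_cancel (by positivity),
    ENNReal.rpow_one]
  exact le_mul_of_one_le_left' ha

/-- Adaptive composition: the inner bound is applied for each `x`, then the outer bound to the
resulting function of `x`. The powers `1 / q` and `q` cancel, so the same exponent survives and only
the constants multiply. -/
lemma MomentClose.bind {q : ℝ} (hq : 1 ≤ q) {a b : ℝ≥0∞} {P P' : PMF X} {f f' : X → PMF Y}
    (h : MomentClose q a P P') (hf : ∀ x, MomentClose q b (f x) (f' x)) :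
    MomentClose q (a * b) (P.bind f) (P'.bind f') := by
  intro g
  rw [mean_bind, mean_bind]
  calc mean P (fun x => mean (f x) g)
      ≤ mean P (fun x => b * mean (f' x) (fun y => g y ^ q) ^ (1 / q)) :=
        mean_mono _ fun x => hf x g
    _ = b * mean P (fun x => mean (f' x) (fun y => g y ^ q) ^ (1 / q)) := mean_const_mul _ _ _
    _ ≤ b * (a * mean P' (fun x => (mean (f' x) (fun y => g y ^ q) ^ (1 / q)) ^ q) ^ (1 / q)) :=
        mul_le_mul_right (h _) _
    _ = a * b * mean P' (fun x => mean (f' x) (fun y => g y ^ q)) ^ (1 / q) := by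
        have : ∀ x, (mean (f' x) (fun y => g y ^ q) ^ (1 / q)) ^ q
            = mean (f' x) (fun y => g y ^ q) := fun x => by
          rw [← ENNReal.rpow_mul, one_div_mul_cancel (by positivity), ENNReal.rpow_one]
        simp only [this]
        ring

/-- The exponent `q = 1` is pure privacy; it serves the regime with few steps compared with `log
(2/δ)`. -/
lemma momentClose_one {a : ℝ≥0∞} {P P' : PMF X} (h : ∀ x, P x ≤ a * P' x) :
    MomentClose 1 a P P' := by
  intro g
  simp only [ENNReal.rpow_one, div_one]
  rw [← mean_const_mul]
  refine ENNReal.tsum_le_tsum fun x => ?_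
  calc P x * g x ≤ a * P' x * g x := mul_le_mul_left (h x) _
    _ = _ := by ring

/-- The second-order bound on the moments of a likelihood ratio close to `1`. -/
lemma rpow_ratio_bound {r α θ : ℝ} (hα : 1 ≤ α) (hαθ : α * θ ≤ 1)
    (h1 : Real.exp (-θ) ≤ r) (h2 : r ≤ Real.exp θ) :
    r ^ α + α ≤ 1 + α ^ 2 * θ ^ 2 + α * r := by
  have hr : 0 < r := (Real.exp_pos _).trans_le h1
  set l := Real.log r with hl
  have hrl : r = Real.exp l := (Real.exp_log hr).symm
  have hl1 : -θ ≤ l := (Real.le_log_iff_exp_le hr).2 h1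
  have hl2 : l ≤ θ := (Real.log_le_iff_le_exp hr).2 h2
  have habs : |l| ≤ θ := abs_le.2 ⟨hl1, hl2⟩
  have hαl : |α * l| ≤ 1 := by
    rw [abs_mul, abs_of_nonneg (by linarith)]
    exact (mul_le_mul_of_nonneg_left habs (by linarith)).trans hαθ
  -- `exp y ≤ 1 + y + y ^ 2` for `|y| ≤ 1`, at `y = α * log r`. The linear term is then replaced by
  -- `α * (r - 1)`, whose average vanishes.
  have hq := (abs_le.1 (Real.abs_exp_sub_one_sub_id_le hαl)).2
  have hpow : r ^ α = Real.exp (α * l) := by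
    rw [Real.rpow_def_of_pos hr, mul_comm]
  have hlr : l + 1 ≤ r := by rw [hrl]; exact Real.add_one_le_exp l
  have hsq : l ^ 2 ≤ θ ^ 2 := sq_le_sq' hl1 hl2
  have : α ^ 2 * l ^ 2 ≤ α ^ 2 * θ ^ 2 := mul_le_mul_of_nonneg_left hsq (by positivity)
  rw [hpow]
  nlinarith

/-- Averaging the pointwise bound under `P'` cancels the first-order terms, since both distributions
have mass `1`. The exponent is therefore quadratic in `θ`, which is the source of the `√m`. -/
lemma tsum_ratio_rpow_le {P P' : PMF X} {α θ : ℝ} (hα : 1 ≤ α)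
    (hαθ : α * θ ≤ 1) (h : ∀ x, P x ≤ ENNReal.ofReal (Real.exp θ) * P' x)
    (h' : ∀ x, P' x ≤ ENNReal.ofReal (Real.exp θ) * P x) :
    ∑' x, (P x / P' x) ^ α * P' x ≤ ENNReal.ofReal (Real.exp (α ^ 2 * θ ^ 2)) := by
  have key : ∀ x, (P x / P' x) ^ α * P' x + ENNReal.ofReal α * P' x
      ≤ ENNReal.ofReal (1 + α ^ 2 * θ ^ 2) * P' x + ENNReal.ofReal α * P x := by
    intro x
    rcases eq_or_ne (P' x) 0 with h0 | h0
    · simp [h0]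
    have hp' : 0 < (P' x).toReal := ENNReal.toReal_pos h0 (P'.apply_ne_top x)
    have e1 : P x = ENNReal.ofReal (P x).toReal := (ENNReal.ofReal_toReal (P.apply_ne_top x)).symm
    have e2 : P' x = ENNReal.ofReal (P' x).toReal :=
      (ENNReal.ofReal_toReal (P'.apply_ne_top x)).symm
    have hx := h x
    have hx' := h' x
    set p := (P x).toReal
    set p' := (P' x).toReal
    have hp : 0 ≤ p := ENNReal.toReal_nonneg
    rw [e1, e2] at hx hx' ⊢
    rw [← ENNReal.ofReal_mul (Real.exp_pos _).le,
      ENNReal.ofReal_le_ofReal_iff (by positivity)] at hx hx'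
    have hb := rpow_ratio_bound (r := p / p') hα hαθ
      (by rw [le_div_iff₀ hp', Real.exp_neg, inv_mul_le_iff₀ (Real.exp_pos _)]; exact hx')
      (by rw [div_le_iff₀ hp']; exact hx)
    have hb' := mul_le_mul_of_nonneg_right hb hp'.le
    rw [← ENNReal.ofReal_div_of_pos hp', ENNReal.ofReal_rpow_of_nonneg (by positivity) (by linarith),
      ← ENNReal.ofReal_mul (by positivity), ← ENNReal.ofReal_mul (by positivity),
      ← ENNReal.ofReal_mul (by positivity), ← ENNReal.ofReal_mul (by positivity),
      ← ENNReal.ofReal_add (by positivity) (by positivity),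
      ← ENNReal.ofReal_add (by positivity) (by positivity)]
    refine ENNReal.ofReal_le_ofReal ?_
    have : α * (p / p') * p' = α * p := by field_simp
    nlinarith
  have hsum := ENNReal.tsum_le_tsum key
  rw [ENNReal.tsum_add, ENNReal.tsum_add, ENNReal.tsum_mul_left, ENNReal.tsum_mul_left,
    ENNReal.tsum_mul_left, P.tsum_coe, P'.tsum_coe] at hsum
  have hle := (ENNReal.add_le_add_iff_right (by simp)).1 hsum
  refine hle.trans ?_
  rw [mul_one]
  refine ENNReal.ofReal_le_ofReal ?_
  linarith [Real.add_one_le_exp (α ^ 2 * θ ^ 2)]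

/-- Hölder's inequality under `P'`, applied to the density `P / P'` and `g`. -/
lemma momentClose_of_ratio {P P' : PMF X} {α q θ : ℝ} (hαq : α.HolderConjugate q)
    (hαθ : α * θ ≤ 1) (h : ∀ x, P x ≤ ENNReal.ofReal (Real.exp θ) * P' x)
    (h' : ∀ x, P' x ≤ ENNReal.ofReal (Real.exp θ) * P x) :
    MomentClose q (ENNReal.ofReal (Real.exp (α * θ ^ 2))) P P' := by
  intro g
  let _ : MeasurableSpace X := ⊤
  have hα0 : 0 < α := hαq.pos
  have hq0 : 0 < q := hαq.symm.pos
  have hfg : ∀ x, P x * g x = ((P x / P' x) * P' x ^ (1 / α)) * (P' x ^ (1 / q) * g x) := by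
    intro x
    rcases eq_or_ne (P' x) 0 with h0 | h0
    · have : P x = 0 := by simpa [h0] using h x
      simp [this]
    · rw [show (P x / P' x) * P' x ^ (1 / α) * (P' x ^ (1 / q) * g x)
        = (P x / P' x) * (P' x ^ (1 / α) * P' x ^ (1 / q)) * g x by ring,
        ← ENNReal.rpow_add _ _ h0 (P'.apply_ne_top x)]
      have : 1 / α + 1 / q = 1 := by
        simpa [one_div] using hαq.inv_add_inv_eq_one
      rw [this, ENNReal.rpow_one, ENNReal.div_mul_cancel h0 (P'.apply_ne_top x)]
  have hH := ENNReal.lintegral_mul_le_Lp_mul_Lq (μ := Measure.count) hαq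
    (f := fun x => (P x / P' x) * P' x ^ (1 / α)) (g := fun x => P' x ^ (1 / q) * g x)
    measurable_from_top.aemeasurable measurable_from_top.aemeasurable
  simp only [lintegral_count, Pi.mul_apply] at hH
  rw [mean, tsum_congr hfg]
  refine hH.trans ?_
  have e1 : ∀ x, (P x / P' x * P' x ^ (1 / α)) ^ α = (P x / P' x) ^ α * P' x := fun x => by
    rw [ENNReal.mul_rpow_of_nonneg _ _ hα0.le, ← ENNReal.rpow_mul, one_div_mul_cancel hα0.ne',
      ENNReal.rpow_one]
  have e2 : ∀ x, (P' x ^ (1 / q) * g x) ^ q = P' x * g x ^ q := fun x => by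
    rw [ENNReal.mul_rpow_of_nonneg _ _ hq0.le, ← ENNReal.rpow_mul, one_div_mul_cancel hq0.ne',
      ENNReal.rpow_one]
  simp only [e1, e2]
  refine mul_le_mul_left ?_ _
  calc (∑' x, (P x / P' x) ^ α * P' x) ^ (1 / α)
      ≤ ENNReal.ofReal (Real.exp (α ^ 2 * θ ^ 2)) ^ (1 / α) :=
        ENNReal.rpow_le_rpow (tsum_ratio_rpow_le hαq.lt.le hαθ h h') (by positivity)
    _ = ENNReal.ofReal (Real.exp (α * θ ^ 2)) := by
        rw [ENNReal.ofReal_rpow_of_nonneg (by positivity) (by positivity), ← Real.exp_mul]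
        congr 2
        field_simp

/-- For an indicator the moment bound is a power `1 / q` of the probability. Young's inequality,
weighted by `ε`, splits it into the multiplicative and the additive term of approximate privacy. -/
lemma MomentClose.outer_le {P P' : PMF X} {α q b ε : ℝ} (hαq : α.HolderConjugate q)
    (h : MomentClose q (ENNReal.ofReal (Real.exp b)) P P') (T : Set X) :
    P.toOuterMeasure T ≤ ENNReal.ofReal (Real.exp ε) * P'.toOuterMeasure T
      + ENNReal.ofReal (Real.exp (α * b - (α - 1) * ε)) := by
  have hα0 : 0 < α := hαq.pos
  have hq0 : 0 < q := hαq.symm.pos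
  have hT := h (T.indicator 1)
  have e : (fun x => (T.indicator (1 : X → ℝ≥0∞) x) ^ q) = T.indicator 1 := by
    funext x
    by_cases hx : x ∈ T <;> simp [hx, hq0]
  rw [e, mean_indicator, mean_indicator] at hT
  refine hT.trans ?_
  have hr : 1 / q = (α - 1) / α := by
    have := hαq.inv_add_inv_eq_one
    rw [one_div]
    field_simp
    field_simp at this
    linarith
  set m := P'.toOuterMeasure T
  have hy := ENNReal.young_inequality (ENNReal.ofReal (Real.exp (b - ε * (1 / q))))
    (ENNReal.ofReal (Real.exp (ε * (1 / q))) * m ^ (1 / q)) hαq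
  rw [← mul_assoc, ← ENNReal.ofReal_mul (Real.exp_pos _).le, ← Real.exp_add,
    sub_add_cancel, ENNReal.mul_rpow_of_nonneg _ _ hq0.le,
    ENNReal.ofReal_rpow_of_nonneg (Real.exp_pos _).le hα0.le,
    ENNReal.ofReal_rpow_of_nonneg (Real.exp_pos _).le hq0.le, ← Real.exp_mul, ← Real.exp_mul,
    ← ENNReal.rpow_mul, one_div_mul_cancel hq0.ne', ENNReal.rpow_one, mul_assoc ε,
    one_div_mul_cancel hq0.ne', mul_one] at hy
  refine hy.trans ?_
  rw [add_comm]
  refine add_le_add ?_ ?_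
  · refine ENNReal.div_le_of_le_mul ?_
    exact le_mul_of_one_le_right' (ENNReal.one_le_ofReal.2 hαq.symm.lt.le)
  · have : (b - ε * (1 / q)) * α = α * b - (α - 1) * ε := by
      rw [hr]; field_simp
    rw [this]
    refine ENNReal.div_le_of_le_mul ?_
    exact le_mul_of_one_le_right' (ENNReal.one_le_ofReal.2 hαq.lt.le)

end Moment

end PrivateDist

namespace PrivateDist

/-! ### Edge counts in graphs of large girth. -/

section Girth

variable {V : Type*}

/-- A walk joining the ends of an edge without using it closes up to a cycle. -/
lemma two_mul_le_length_of_adj {H : SimpleGraph V} {k : ℕ}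
    (hH : ∀ (a : V) (c : H.Walk a a), c.IsCycle → 2 * k < c.length) {a b : V} (hab : H.Adj a b)
    (p : H.Walk a b) (hp : s(a, b) ∉ p.edges) : 2 * k ≤ p.length := by
  classical
  have hc : (SimpleGraph.Walk.cons hab.symm p.bypass).IsCycle := by
    rw [SimpleGraph.Walk.cons_isCycle_iff]
    refine ⟨p.bypass_isPath, fun h => hp ?_⟩
    rw [Sym2.eq_swap]
    exact p.edges_bypass_subset_edges h
  have := hH _ _ hc
  have h2 := p.length_bypass_le_length
  rw [SimpleGraph.Walk.length_cons] at this
  omega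

/-- In a graph of large girth, the edges meeting a ball are the parent edges of a breadth-first
search tree. -/
lemma ncard_edges_ball_le [Finite V] {H : SimpleGraph V} {k r : ℕ} (hr : r < k)
    (hH : ∀ (a : V) (c : H.Walk a a), c.IsCycle → 2 * k < c.length) (v : V) :
    {e ∈ H.edgeSet | ∃ x ∈ e, H.Reachable v x ∧ H.dist v x ≤ r}.ncard
      ≤ {x | H.Reachable v x ∧ H.dist v x ≤ r + 1}.ncard := by
  classical
  have hP : ∀ x, ∃ p : H.Reachable v x → H.Walk v x, ∀ h, (p h).length = H.dist v x := by
    intro x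
    by_cases h : H.Reachable v x
    · obtain ⟨p, hp⟩ := h.exists_walk_length_eq_dist
      exact ⟨fun _ => p, fun _ => hp⟩
    · exact ⟨fun h' => (h h').elim, fun h' => (h h').elim⟩
  choose P hP using hP
  -- The parent edge of `y`; the loop `s(y, y)` is a dummy value for unreachable vertices.
  let f : V → Sym2 V := fun y =>
    if h : H.Reachable v y then s((P y h).penultimate, y) else s(y, y)
  refine le_trans (Set.ncard_le_ncard (t := f '' {x | H.Reachable v x ∧ H.dist v x ≤ r + 1}) ?_
    (Set.toFinite _)) (Set.ncard_image_le (Set.toFinite _))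
  have key : ∀ x y, H.Adj x y → H.Reachable v x → H.Reachable v y → H.dist v x ≤ r →
      H.dist v x ≤ H.dist v y → H.dist v y ≤ r + 1 → s(x, y) = f y := by
    intro x y hxy hvx hvy hx hle hy
    have hPy : (P y hvy).IsPath := SimpleGraph.Walk.isPath_of_length_eq_dist _ (hP y hvy)
    by_cases hmem : s(x, y) ∈ (P y hvy).edges
    · have := hPy.eq_penultimate_of_mem_edges (by rwa [Sym2.eq_swap] at hmem)
      simp only [f, hvy, dif_pos, ← this]
    · exfalso
      have hmem' : s(x, y) ∉ (P x hvx).edges := by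
        intro hm
        have hys : y ∈ (P x hvx).support := SimpleGraph.Walk.snd_mem_support_of_mem_edges _ hm
        have h1 := SimpleGraph.dist_le ((P x hvx).takeUntil y hys)
        have h2 := SimpleGraph.Walk.length_takeUntil_lt_length hys hxy.ne.symm
        rw [hP] at h2
        omega
      -- A non-tree edge would close a cycle through `v`: the two shortest paths have total length
      -- at most `2 * r + 1 < 2 * k`.
      have := two_mul_le_length_of_adj hH hxy ((P x hvx).reverse.append (P y hvy))
        (by simp [hmem, hmem'])
      rw [SimpleGraph.Walk.length_append, SimpleGraph.Walk.length_reverse, hP, hP] at this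
      omega
  rintro e ⟨he, x, hxe, hvx, hx⟩
  obtain ⟨y, rfl⟩ := Sym2.mem_iff_exists.1 hxe
  have hxy : H.Adj x y := he
  have hvy : H.Reachable v y := hvx.trans hxy.reachable
  have hy : H.dist v y ≤ H.dist v x + 1 := by
    obtain ⟨p, hp⟩ := hvx.exists_walk_length_eq_dist
    have := SimpleGraph.dist_le (p.append hxy.toWalk)
    simpa [hp] using this
  rcases le_total (H.dist v x) (H.dist v y) with hle | hle
  · exact ⟨y, ⟨hvy, by omega⟩, (key x y hxy hvx hvy hx hle (by omega)).symm⟩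
  · refine ⟨x, ⟨hvx, by omega⟩, ?_⟩
    rw [Sym2.eq_swap]
    exact (key y x hxy.symm hvy hvx (by omega) hle (by omega)).symm

/-- Otherwise `k` successive growths by more than a factor `c` would give a ball with more than `c ^
k` vertices. -/
lemma exists_ball_growth_le [Finite V] (H : SimpleGraph V) {k : ℕ} (hk : 1 ≤ k) {c : ℝ}
    (hc : 0 ≤ c) (hV : (Nat.card V : ℝ) ≤ c ^ k) (v : V) :
    ∃ r < k, ({x | H.Reachable v x ∧ H.dist v x ≤ r + 1}.ncard : ℝ)
      ≤ c * ({x | H.Reachable v x ∧ H.dist v x ≤ r}.ncard : ℝ) := by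
  by_contra! hcon
  have hlow : ∀ i < k, c ^ i ≤ ({x | H.Reachable v x ∧ H.dist v x ≤ i}.ncard : ℝ) := by
    intro i
    induction i with
    | zero =>
      intro _
      rw [pow_zero]
      have : 0 < {x | H.Reachable v x ∧ H.dist v x ≤ 0}.ncard :=
        (Set.ncard_pos (Set.toFinite _)).2 ⟨v, by simp⟩
      exact_mod_cast this
    | succ i ih =>
      intro hi
      have h1 := hcon i (by omega)
      have h2 := mul_le_mul_of_nonneg_left (ih (by omega)) hc
      rw [pow_succ']
      linarith
  obtain ⟨j, rfl⟩ : ∃ j, k = j + 1 := ⟨k - 1, by omega⟩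
  have h1 := hcon j (by omega)
  have h2 := mul_le_mul_of_nonneg_left (hlow j (by omega)) hc
  have h3 : ({x | H.Reachable v x ∧ H.dist v x ≤ j + 1}.ncard : ℝ) ≤ Nat.card V := by
    exact_mod_cast Set.ncard_le_card _
  rw [pow_succ'] at hV
  linarith

/-- Delete all edges meeting a ball that grows by a factor at most `c`: they are charged to the
vertices of the ball, `c` each, and the ball leaves the support. Only `W` shrinks in the induction;
the vertex type stays fixed, so `hV` persists. -/
lemma ncard_edgeSet_le_of_support [Finite V] {k : ℕ} (hk : 1 ≤ k) {c : ℝ} (hc : 0 ≤ c)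
    (hV : (Nat.card V : ℝ) ≤ c ^ k) (W : Finset V) :
    ∀ H : SimpleGraph V, H.support ⊆ W →
      (∀ (a : V) (p : H.Walk a a), p.IsCycle → 2 * k < p.length) →
      (H.edgeSet.ncard : ℝ) ≤ c * W.card := by
  classical
  induction W using Finset.strongInduction with
  | H W ih =>
    intro H hW hH
    rcases W.eq_empty_or_nonempty with rfl | ⟨v, hv⟩
    · have : H = ⊥ := by
        ext x y
        simp only [SimpleGraph.bot_adj, iff_false]
        intro h
        simpa using hW (H.mem_support.2 ⟨y, h⟩)
      simp [this]
    obtain ⟨r, hr, hgrow⟩ := exists_ball_growth_le H hk hc hV v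
    set B : Set V := {x | H.Reachable v x ∧ H.dist v x ≤ r} with hB
    set EB : Set (Sym2 V) := {e ∈ H.edgeSet | ∃ x ∈ e, H.Reachable v x ∧ H.dist v x ≤ r} with hEB
    have hEBle := ncard_edges_ball_le hr hH v
    have hvB : v ∈ B := by simp [hB]
    have hBW : B ⊆ W := by
      rintro x ⟨hx, -⟩
      rcases eq_or_ne x v with rfl | hne
      · exact hv
      · obtain ⟨p⟩ := hx.symm
        cases p with
        | nil => exact absurd rfl hne
        | cons h _ => exact hW (H.mem_support.2 ⟨_, h⟩)
    have hlt : W.filter (fun x => x ∉ B) ⊂ W :=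
      Finset.filter_ssubset.2 ⟨v, hv, by simpa using hvB⟩
    have hrec := ih _ hlt (H.deleteEdges EB) ?_ ?_
    · rw [SimpleGraph.edgeSet_deleteEdges] at hrec
      have h1 : H.edgeSet.ncard ≤ (H.edgeSet \ EB).ncard + EB.ncard := by
        have := Set.ncard_le_ncard (s := H.edgeSet) (t := (H.edgeSet \ EB) ∪ EB)
          (by rw [Set.sdiff_union_self]; exact Set.subset_union_left) (Set.toFinite _)
        exact this.trans (Set.ncard_union_le _ _)
      have h2 : (W.filter (fun x => x ∉ B)).card + B.ncard = W.card := by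
        have : B.ncard = (W.filter (fun x => x ∈ B)).card := by
          rw [← Set.ncard_coe_finset]
          congr 1
          ext x
          simp only [Finset.coe_filter, Set.mem_ofPred_eq]
          exact ⟨fun h => ⟨hBW h, h⟩, fun h => h.2⟩
        rw [this, add_comm]
        exact Finset.card_filter_add_card_filter_not _
      have h1' : (H.edgeSet.ncard : ℝ) ≤ (H.edgeSet \ EB).ncard + EB.ncard := by exact_mod_cast h1
      have h2' : ((W.filter (fun x => x ∉ B)).card : ℝ) + B.ncard = W.card := by exact_mod_cast h2
      have h3 : (EB.ncard : ℝ) ≤ c * B.ncard := le_trans (by exact_mod_cast hEBle) hgrow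
      rw [← h2', mul_add]
      linarith
    · intro x hx
      obtain ⟨y, hxy⟩ := SimpleGraph.mem_support _ |>.1 hx
      rw [SimpleGraph.deleteEdges_adj] at hxy
      simp only [Finset.coe_filter, Set.mem_ofPred_eq]
      exact ⟨hW (H.mem_support.2 ⟨y, hxy.1⟩),
        fun hxB => hxy.2 ⟨hxy.1, x, Sym2.mem_mk_left _ _, hxB⟩⟩
    · intro a p hp
      have := hH a (p.mapLe (H.deleteEdges_le EB)) (hp.mapLe _)
      simpa using this

/-- A graph on at most `c ^ k` vertices without cycles of length at most `2 * k` has at most `c`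
times as many edges as vertices. -/
lemma ncard_edgeSet_le [Fintype V] {k : ℕ} (hk : 1 ≤ k) {c : ℝ} (hc : 0 ≤ c)
    (hV : (Fintype.card V : ℝ) ≤ c ^ k) (H : SimpleGraph V)
    (hH : ∀ (a : V) (p : H.Walk a a), p.IsCycle → 2 * k < p.length) :
    (H.edgeSet.ncard : ℝ) ≤ c * Fintype.card V :=
  ncard_edgeSet_le_of_support hk hc (by rwa [Nat.card_eq_fintype_card]) Finset.univ H
    (by simp) hH

end Girth

end PrivateDist

namespace PrivateDist

/-! ### Weighted distances and their sensitivity to the weights. -/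

section Distance

variable {V : Type*} {G : SimpleGraph V}

lemma walkWeight_append (w : G.edgeSet → ℝ≥0) {u v x : V} (p : G.Walk u v) (q : G.Walk v x) :
    walkWeight w (p.append q) = walkWeight w p + walkWeight w q := by
  induction p with
  | nil => simp [walkWeight]
  | cons h p ih => simp [walkWeight, ih, add_assoc]

lemma walkWeight_reverse (w : G.edgeSet → ℝ≥0) {u v : V} (p : G.Walk u v) :
    walkWeight w p.reverse = walkWeight w p := by
  induction p with
  | nil => rfl
  | @cons a b c h p ih =>
    have : w ⟨s(b, a), h.symm⟩ = w ⟨s(a, b), h⟩ := by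
      congr 1
      exact Subtype.ext Sym2.eq_swap
    simp [walkWeight, walkWeight_append, ih, this, add_comm]

lemma walkWeight_bypass_le [DecidableEq V] (w : G.edgeSet → ℝ≥0) {u v : V} (p : G.Walk u v) :
    walkWeight w p.bypass ≤ walkWeight w p := by
  induction p with
  | nil => rfl
  | @cons a b c h p ih =>
    rw [SimpleGraph.Walk.bypass]
    split_ifs with hs
    · have := walkWeight_append w (p.bypass.takeUntil a hs) (p.bypass.dropUntil a hs)
      rw [SimpleGraph.Walk.take_spec] at this
      calc walkWeight w (p.bypass.dropUntil a hs) ≤ walkWeight w p.bypass := by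
            rw [this]; exact le_add_self
        _ ≤ walkWeight w p := ih
        _ ≤ _ := le_add_self
    · simp only [walkWeight]
      gcongr

lemma walkWeight_eq_sum [DecidableEq V] [Fintype G.edgeSet] (w : G.edgeSet → ℝ≥0) {u v : V}
    (p : G.Walk u v) (hp : p.IsTrail) :
    walkWeight w p = ∑ e : G.edgeSet, if (e : Sym2 V) ∈ p.edges then w e else 0 := by
  induction p with
  | nil => simp [walkWeight]
  | @cons a b c h p ih =>
    rw [SimpleGraph.Walk.isTrail_cons] at hp
    have hsplit : ∀ e : G.edgeSet,
        (if (e : Sym2 V) ∈ (SimpleGraph.Walk.cons h p).edges then w e else 0)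
          = (if e = ⟨s(a, b), h⟩ then w e else 0) + if (e : Sym2 V) ∈ p.edges then w e else 0 := by
      intro e
      by_cases he : e = ⟨s(a, b), h⟩
      · subst he
        simp [hp.2]
      · have : (e : Sym2 V) ≠ s(a, b) := fun h' => he (Subtype.ext h')
        simp [he, this]
    simp only [walkWeight, hsplit, Finset.sum_add_distrib, ih hp.1, Finset.sum_ite_eq',
      Finset.mem_univ, if_true]

lemma wdist_self (w : G.edgeSet → ℝ≥0) (u : V) : wdist w u u = 0 :=
  le_antisymm (iInf_le_of_le SimpleGraph.Walk.nil (by simp [walkWeight])) bot_le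

lemma wdist_comm (w : G.edgeSet → ℝ≥0) (u v : V) : wdist w u v = wdist w v u := by
  have key : ∀ a b : V, wdist w a b ≤ wdist w b a := fun a b =>
    le_iInf fun p => iInf_le_of_le p.reverse (by rw [walkWeight_reverse])
  exact le_antisymm (key u v) (key v u)

lemma wdist_triangle (w : G.edgeSet → ℝ≥0) (u v x : V) :
    wdist w u x ≤ wdist w u v + wdist w v x := by
  simp only [wdist, ENNReal.iInf_add, ENNReal.add_iInf]
  refine le_iInf fun q => le_iInf fun p => iInf_le_of_le (p.append q) ?_
  rw [walkWeight_append, ENNReal.coe_add]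

lemma wdist_ne_top {w : G.edgeSet → ℝ≥0} {u v : V} (h : G.Reachable u v) : wdist w u v ≠ ⊤ := by
  obtain ⟨p⟩ := h
  exact ne_top_of_le_ne_top ENNReal.coe_ne_top (iInf_le _ p)

lemma wdist_eq_top {w : G.edgeSet → ℝ≥0} {u v : V} (h : ¬ G.Reachable u v) : wdist w u v = ⊤ := by
  have : IsEmpty (G.Walk u v) := ⟨fun p => h ⟨p⟩⟩
  exact iInf_of_empty _

/-- Passing to a simple path makes each edge count at most once, so the `ℓ₁` change of the weights
bounds the change of the distance. -/
lemma wdist_le_add [Fintype G.edgeSet] (w w' : G.edgeSet → ℝ≥0) (u v : V) :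
    wdist w u v ≤ wdist w' u v + ENNReal.ofReal (∑ e, |(w e : ℝ) - w' e|) := by
  classical
  simp only [wdist, ENNReal.iInf_add]
  refine le_iInf fun p => iInf_le_of_le p.bypass ?_
  have htrail := p.bypass_isPath.isTrail
  have h1 : (walkWeight w p.bypass : ℝ) ≤ walkWeight w' p.bypass + ∑ e, |(w e : ℝ) - w' e| := by
    rw [walkWeight_eq_sum w _ htrail, walkWeight_eq_sum w' _ htrail]
    push_cast
    rw [← Finset.sum_add_distrib]
    refine Finset.sum_le_sum fun e _ => ?_
    split_ifs
    · linarith [le_abs_self ((w e : ℝ) - w' e)]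
    · simp
  have h2 : (walkWeight w' p.bypass : ℝ) ≤ walkWeight w' p := by
    exact_mod_cast walkWeight_bypass_le w' p
  rw [← ENNReal.ofReal_coe_nnreal, ← ENNReal.ofReal_coe_nnreal,
    ← ENNReal.ofReal_add (by positivity) (Finset.sum_nonneg fun _ _ => abs_nonneg _)]
  exact ENNReal.ofReal_le_ofReal (by linarith)

/-- The distance as a real number, for vertices joined by a path. -/
noncomputable def realDist (w : G.edgeSet → ℝ≥0) (u v : V) : ℝ := (wdist w u v).toReal

lemma realDist_nonneg (w : G.edgeSet → ℝ≥0) (u v : V) : 0 ≤ realDist w u v :=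
  ENNReal.toReal_nonneg

lemma ofReal_realDist {w : G.edgeSet → ℝ≥0} {u v : V} (h : G.Reachable u v) :
    ENNReal.ofReal (realDist w u v) = wdist w u v :=
  ENNReal.ofReal_toReal (wdist_ne_top h)

lemma abs_realDist_sub_le [Fintype G.edgeSet] (w w' : G.edgeSet → ℝ≥0) {u v : V}
    (h : G.Reachable u v) :
    |realDist w u v - realDist w' u v| ≤ ∑ e, |(w e : ℝ) - w' e| := by
  have key : ∀ a b : G.edgeSet → ℝ≥0,
      realDist a u v - realDist b u v ≤ ∑ e, |(a e : ℝ) - b e| := by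
    intro a b
    have hs : (0 : ℝ) ≤ ∑ e, |(a e : ℝ) - b e| := Finset.sum_nonneg fun _ _ => abs_nonneg _
    have := wdist_le_add a b u v
    rw [← ofReal_realDist h, ← ofReal_realDist h, ← ENNReal.ofReal_add (realDist_nonneg _ _ _) hs,
      ENNReal.ofReal_le_ofReal_iff (add_nonneg (realDist_nonneg _ _ _) hs)] at this
    linarith
  refine abs_sub_le_iff.2 ⟨key w w', ?_⟩
  simpa only [abs_sub_comm] using key w' w

lemma measurable_realDist [Fintype G.edgeSet] {u v : V} (h : G.Reachable u v) :
    Measurable fun w : G.edgeSet → ℝ≥0 => realDist w u v := by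
  refine Continuous.measurable (continuous_iff_continuousAt.2 fun w₀ => ?_)
  refine tendsto_iff_dist_tendsto_zero.2 ?_
  refine squeeze_zero (fun _ => dist_nonneg) (fun w => abs_realDist_sub_le w w₀ h) ?_
  have hc : Continuous fun w : G.edgeSet → ℝ≥0 => ∑ e, |(w e : ℝ) - w₀ e| := by fun_prop
  simpa using hc.tendsto w₀

end Distance

end PrivateDist

namespace PrivateDist

/-! ### The greedy spanner: girth, size and cheap chains. -/

section Chains

variable {σ : Type*}

/-- `Chain h n c u v`: the weighted links recorded in `h`, traversed in either direction, join
`u` to `v` in `n` hops of total recorded weight `c`. -/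
inductive Chain (h : List ((σ × σ) × ℕ)) : ℕ → ℕ → σ → σ → Prop
  | nil (u : σ) : Chain h 0 0 u u
  | cons {n c z : ℕ} {a b v : σ} (hab : ((a, b), z) ∈ h ∨ ((b, a), z) ∈ h)
      (hc : Chain h n c b v) : Chain h (n + 1) (z + c) a v

lemma Chain.mono {h h' : List ((σ × σ) × ℕ)} (hh : h ⊆ h') {n c : ℕ} {u v : σ}
    (H : Chain h n c u v) : Chain h' n c u v := by
  induction H with
  | nil u => exact .nil u
  | cons hab _ ih => exact .cons (hab.imp (fun x => hh x) fun x => hh x) ih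

lemma Chain.le_mul {h : List ((σ × σ) × ℕ)} {B : ℝ} (hB : ∀ y ∈ h, (y.2 : ℝ) ≤ B) {n c : ℕ}
    {u v : σ} (H : Chain h n c u v) : (c : ℝ) ≤ n * B := by
  induction H with
  | nil u => simp
  | cons hab _ ih =>
    have : _ ≤ B := hab.elim (hB _) (hB _)
    push_cast at *
    linarith

/-- The terminals `u` and `v` are joined in fewer than `2 * k` hops. -/
def IsCovered (k : ℕ) (h : List ((σ × σ) × ℕ)) (e : σ × σ) : Prop :=
  ∃ n c, n < 2 * k ∧ Chain h n c e.1 e.2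

lemma IsCovered.mono {k : ℕ} {h h' : List ((σ × σ) × ℕ)} (hh : h ⊆ h') {e : σ × σ}
    (H : IsCovered k h e) : IsCovered k h' e := by
  obtain ⟨n, c, hn, H⟩ := H
  exact ⟨n, c, hn, H.mono hh⟩

/-- The admissible pairs that are not covered yet. -/
def uncovered (R : σ × σ → Prop) (k : ℕ) (h : List ((σ × σ) × ℕ)) : Set (σ × σ) :=
  {e | R e ∧ ¬ IsCovered k h e}

/-- Every link recorded in `h` was nearly minimal, up to `t`, among the pairs uncovered when it
was added, and was recorded with a weight at most `t` too small. -/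
def Good (R : σ × σ → Prop) (k : ℕ) (x : σ × σ → ℝ) (t : ℝ) : List ((σ × σ) × ℕ) → Prop
  | [] => True
  | y :: h => Good R k x t h ∧ y.1 ∈ uncovered R k h ∧ (∀ f ∈ uncovered R k h, (y.2 : ℝ) ≤ x f + t)
      ∧ x y.1 ≤ y.2 + t

/-- The graph of recorded links. -/
def linkGraph (h : List ((σ × σ) × ℕ)) : SimpleGraph σ :=
  SimpleGraph.fromEdgeSet {e | ∃ y ∈ h, s(y.1.1, y.1.2) = e}

lemma exists_chain_of_walk {h : List ((σ × σ) × ℕ)} {u v : σ} (p : (linkGraph h).Walk u v) :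
    ∃ c, Chain h p.length c u v := by
  induction p with
  | nil => exact ⟨0, .nil _⟩
  | @cons a b v hab p ih =>
    obtain ⟨c, hc⟩ := ih
    rw [linkGraph, SimpleGraph.fromEdgeSet_adj] at hab
    obtain ⟨⟨⟨⟨a', b'⟩, z⟩, hy, he⟩, -⟩ := hab
    refine ⟨z + c, .cons ?_ hc⟩
    rcases Sym2.eq_iff.1 he with ⟨rfl, rfl⟩ | ⟨rfl, rfl⟩
    · exact .inl hy
    · exact .inr hy

lemma exists_append_cons_of_mem_edges {H : SimpleGraph σ} {u v : σ} (p : H.Walk u v) {e : Sym2 σ}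
    (he : e ∈ p.edges) : ∃ (a b : σ) (hab : H.Adj a b) (q₁ : H.Walk u a) (q₂ : H.Walk b v),
      s(a, b) = e ∧ p = q₁.append (.cons hab q₂) := by
  induction p with
  | nil => simp at he
  | @cons a b v hab p ih =>
    rw [SimpleGraph.Walk.edges_cons, List.mem_cons] at he
    rcases he with rfl | he
    · exact ⟨a, b, hab, .nil, p, rfl, rfl⟩
    · obtain ⟨a', b', hab', q₁, q₂, he', rfl⟩ := ih he
      exact ⟨a', b', hab', .cons hab q₁, q₂, he', rfl⟩

variable {R : σ × σ → Prop} {k : ℕ} {x : σ × σ → ℝ} {t : ℝ}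

lemma mem_edgeSet_linkGraph_cons {y : (σ × σ) × ℕ} {h : List ((σ × σ) × ℕ)} {e : Sym2 σ}
    (he : e ∈ (linkGraph (y :: h)).edgeSet) (hne : e ≠ s(y.1.1, y.1.2)) :
    e ∈ (linkGraph h).edgeSet := by
  simp only [linkGraph, SimpleGraph.edgeSet_fromEdgeSet] at he ⊢
  obtain ⟨⟨y', hy', rfl⟩, hd⟩ := he
  rcases List.mem_cons.1 hy' with rfl | hy'
  · exact absurd rfl hne
  · exact ⟨⟨y', hy', rfl⟩, hd⟩

/-- Remove the newest link from a cycle containing it: the rest is a walk between its ends through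
older links. These ends were uncovered, so the walk has at least `2 * k` hops. -/
lemma Good.length_lt_of_isCycle {h : List ((σ × σ) × ℕ)} (hG : Good R k x t h) (a : σ)
    (p : (linkGraph h).Walk a a) (hp : p.IsCycle) : 2 * k < p.length := by
  induction h generalizing a with
  | nil =>
    cases p with
    | nil => exact absurd rfl hp.ne_nil
    | cons hab _ => simp [linkGraph] at hab
  | cons y h ih =>
    by_cases hy : s(y.1.1, y.1.2) ∈ p.edges
    · obtain ⟨b, c, hbc, q₁, q₂, he, rfl⟩ := exists_append_cons_of_mem_edges p hy
      have hnd := hp.isTrail.edges_nodup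
      rw [SimpleGraph.Walk.edges_append, SimpleGraph.Walk.edges_cons, he] at hnd
      have hq : s(y.1.1, y.1.2) ∉ (q₂.append q₁).edges := by
        rw [SimpleGraph.Walk.edges_append, List.mem_append]
        rw [List.nodup_append'] at hnd
        obtain ⟨_, h2, h3⟩ := hnd
        rintro (h' | h')
        · exact (List.nodup_cons.1 h2).1 h'
        · exact h3 h' (List.mem_cons_self)
      have htr : ∀ e ∈ (q₂.append q₁).edges, e ∈ (linkGraph h).edgeSet := fun e he' =>
        mem_edgeSet_linkGraph_cons (SimpleGraph.Walk.edges_subset_edgeSet _ he')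
          fun h' => hq (h' ▸ he')
      set q := (q₂.append q₁).transfer (linkGraph h) htr with hqdef
      have hlen : q.length = q₂.length + q₁.length := by
        rw [hqdef, SimpleGraph.Walk.length_transfer, SimpleGraph.Walk.length_append]
      have hcov : ∀ r : (linkGraph h).Walk y.1.1 y.1.2, 2 * k ≤ r.length := by
        intro r
        by_contra! hlt
        obtain ⟨w, hw⟩ := exists_chain_of_walk r
        exact hG.2.1.2 ⟨_, w, hlt, hw⟩
      have hle : 2 * k ≤ q.length := by
        clear_value q
        rcases Sym2.eq_iff.1 he with ⟨rfl, rfl⟩ | ⟨rfl, rfl⟩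
        · simpa using hcov q.reverse
        · exact hcov q
      rw [SimpleGraph.Walk.length_append, SimpleGraph.Walk.length_cons]
      omega
    · have htr : ∀ e ∈ p.edges, e ∈ (linkGraph h).edgeSet := fun e he =>
        mem_edgeSet_linkGraph_cons (SimpleGraph.Walk.edges_subset_edgeSet _ he)
          fun h' => hy (h' ▸ he)
      simpa using ih hG.1 a (p.transfer _ htr) (hp.transfer htr)

/-- As `k ≥ 1`, chains of zero hops and of one hop count as covering, so no loop and no repeated
link is ever recorded. -/
lemma Good.length_eq_ncard [Finite σ] (hk : 1 ≤ k) {h : List ((σ × σ) × ℕ)}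
    (hG : Good R k x t h) : h.length = (linkGraph h).edgeSet.ncard := by
  induction h with
  | nil => simp [linkGraph]
  | cons y h ih =>
    have hdiag : y.1.1 ≠ y.1.2 := fun h' => hG.2.1.2 ⟨0, 0, by omega, by rw [h']; exact .nil _⟩
    have hnew : s(y.1.1, y.1.2) ∉ (linkGraph h).edgeSet := by
      intro hm
      have hadj : (linkGraph h).Adj y.1.1 y.1.2 := hm
      obtain ⟨c, hc⟩ := exists_chain_of_walk hadj.toWalk
      exact hG.2.1.2 ⟨_, c, by simp; omega, hc⟩
    have hins : (linkGraph (y :: h)).edgeSet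
        = insert s(y.1.1, y.1.2) (linkGraph h).edgeSet := by
      ext e
      constructor
      · intro he
        by_cases hne : e = s(y.1.1, y.1.2)
        · exact .inl hne
        · exact .inr (mem_edgeSet_linkGraph_cons he hne)
      · simp only [linkGraph, SimpleGraph.edgeSet_fromEdgeSet]
        rintro (rfl | ⟨⟨y', hy', rfl⟩, hd⟩)
        · exact ⟨⟨y, List.mem_cons_self, rfl⟩, by simpa using hdiag⟩
        · exact ⟨⟨y', List.mem_cons_of_mem _ hy', rfl⟩, hd⟩
    rw [hins, Set.ncard_insert_of_notMem hnew (Set.toFinite _), List.length_cons, ih hG.1]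

lemma Good.length_le [Fintype σ] (hk : 1 ≤ k) {h : List ((σ × σ) × ℕ)} (hG : Good R k x t h)
    {c : ℝ} (hc : 0 ≤ c) (hV : (Fintype.card σ : ℝ) ≤ c ^ k) :
    (h.length : ℝ) ≤ c * Fintype.card σ := by
  rw [hG.length_eq_ncard hk]
  exact ncard_edgeSet_le hk hc hV _ hG.length_lt_of_isCycle

lemma uncovered_anti {h h' : List ((σ × σ) × ℕ)} (hh : h ⊆ h') :
    uncovered R k h' ⊆ uncovered R k h := fun _ he => ⟨he.1, fun hc => he.2 (hc.mono hh)⟩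

/-- A pair uncovered now was uncovered at every earlier step, so it competed with each recorded
link. -/
lemma Good.le_of_mem {h : List ((σ × σ) × ℕ)} (hG : Good R k x t h) {f : σ × σ}
    (hf : f ∈ uncovered R k h) : ∀ y ∈ h, (y.2 : ℝ) ≤ x f + t := by
  induction h with
  | nil => simp
  | cons y h ih =>
    have hf' := uncovered_anti (List.subset_cons_self y h) hf
    intro y' hy'
    rcases List.mem_cons.1 hy' with rfl | hy'
    · exact hG.2.2.1 f hf'
    · exact ih hG.1 hf' y' hy'

lemma Good.rel_of_mem {h : List ((σ × σ) × ℕ)} (hG : Good R k x t h) :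
    ∀ y ∈ h, R y.1 ∧ x y.1 ≤ y.2 + t := by
  induction h with
  | nil => simp
  | cons y h ih =>
    intro y' hy'
    rcases List.mem_cons.1 hy' with rfl | hy'
    · exact ⟨hG.2.1.1, hG.2.2.2⟩
    · exact ih hG.1 y' hy'

/-- Consider the link that first covers `e`. Just before it, `e` was still a candidate, so this link
and all older ones have recorded weight at most `x e + t`. -/
lemma Good.exists_cheap_chain {h : List ((σ × σ) × ℕ)} (hG : Good R k x t h) {e : σ × σ}
    (hR : R e) (he : IsCovered k h e) :
    ∃ n c : ℕ, n < 2 * k ∧ Chain h n c e.1 e.2 ∧ (c : ℝ) ≤ n * (x e + t) := by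
  induction h with
  | nil =>
    obtain ⟨n, c, hn, H⟩ := he
    exact ⟨n, c, hn, H, H.le_mul (by simp)⟩
  | cons y h ih =>
    by_cases he' : IsCovered k h e
    · obtain ⟨n, c, hn, H, hc⟩ := ih hG.1 he'
      exact ⟨n, c, hn, H.mono (List.subset_cons_self y h), hc⟩
    · obtain ⟨n, c, hn, H⟩ := he
      have hmem : e ∈ uncovered R k h := ⟨hR, he'⟩
      refine ⟨n, c, hn, H, H.le_mul fun y' hy' => ?_⟩
      rcases List.mem_cons.1 hy' with rfl | hy'
      · exact hG.2.2.1 e hmem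
      · exact hG.1.le_of_mem hmem y' hy'

end Chains

/-! ### From recorded chains to accurate estimates. -/

section Estimate

variable {V : Type*} {G : SimpleGraph V} {S : Finset V}

/-- The estimated distance: the cheapest recorded chain with fewer than `2 * k` hops, in units of
`1 / η`. -/
noncomputable def estimate (k : ℕ) (η : ℝ) (h : List ((S × S) × ℕ)) (u v : S) : ℝ≥0∞ :=
  ⨅ (n : ℕ) (c : ℕ) (_ : n < 2 * k ∧ Chain h n c u v), ENNReal.ofReal (c / η)

lemma wdist_le_of_chain {w : G.edgeSet → ℝ≥0} {η t : ℝ} (hη : 0 < η) (ht : 0 ≤ t)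
    {h : List ((S × S) × ℕ)}
    (hh : ∀ y ∈ h, G.Reachable (y.1.1 : V) y.1.2 ∧
      η * realDist w (y.1.1 : V) y.1.2 ≤ y.2 + t) {n c : ℕ} {u v : S} (H : Chain h n c u v) :
    wdist w (u : V) v ≤ ENNReal.ofReal ((c + n * t) / η) := by
  induction H with
  | nil u => simp [wdist_self]
  | @cons n c z a b v hab _ ih =>
    have hstep : wdist w (a : V) b ≤ ENNReal.ofReal ((z + t) / η) := by
      have key : ∀ a b : S, ((a, b), z) ∈ h → wdist w (a : V) b ≤ ENNReal.ofReal ((z + t) / η) := by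
        intro a b hm
        obtain ⟨hr, hd⟩ := hh _ hm
        rw [← ofReal_realDist hr]
        refine ENNReal.ofReal_le_ofReal ?_
        rw [le_div_iff₀ hη, mul_comm]
        exact hd
      rcases hab with hab | hab
      · exact key a b hab
      · rw [wdist_comm]
        exact key b a hab
    refine (wdist_triangle w (a : V) b v).trans ((add_le_add hstep ih).trans ?_)
    rw [← ENNReal.ofReal_add (by positivity) (by positivity)]
    refine ENNReal.ofReal_le_ofReal (le_of_eq ?_)
    push_cast
    ring

lemma isAccurate_estimate {w : G.edgeSet → ℝ≥0} {k : ℕ} (hk : 1 ≤ k) {η t : ℝ} (hη : 0 < η)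
    (ht : 0 ≤ t) {h : List ((S × S) × ℕ)}
    (hG : Good (fun e : S × S => G.Reachable (e.1 : V) e.2) k
      (fun e => η * realDist w (e.1 : V) e.2) t h)
    (hU : uncovered (fun e : S × S => G.Reachable (e.1 : V) e.2) k h = ∅) :
    IsAccurate w S (2 * (k : ℝ) - 1) ((2 * k - 1) * (t / η)) (estimate k η h) := by
  have hk' : (1 : ℝ) ≤ k := by exact_mod_cast hk
  have hγ : (0 : ℝ) < 2 * k - 1 := by linarith
  have hn1 : ∀ n : ℕ, n < 2 * k → (n : ℝ) ≤ 2 * k - 1 := by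
    intro n hn
    have : (n : ℝ) + 1 ≤ 2 * k := by exact_mod_cast hn
    linarith
  have htη : 0 ≤ t / η := by positivity
  intro u v
  constructor
  · simp only [estimate, ENNReal.iInf_add]
    refine le_iInf fun n => le_iInf fun c => le_iInf fun hnc => ?_
    refine (wdist_le_of_chain hη ht hG.rel_of_mem hnc.2).trans ?_
    rw [← ENNReal.ofReal_add (by positivity) (by positivity)]
    refine ENNReal.ofReal_le_ofReal ?_
    have := mul_le_mul_of_nonneg_right (hn1 n hnc.1) htη
    rw [add_div, mul_div_assoc]
    linarith
  · by_cases hr : G.Reachable (u : V) v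
    · have hcov : IsCovered k h (u, v) := by
        by_contra hcon
        have : (u, v) ∈ (∅ : Set (S × S)) := hU ▸ ⟨hr, hcon⟩
        exact this
      obtain ⟨n, c, hn, H, hc⟩ := hG.exists_cheap_chain (e := (u, v)) hr hcov
      refine (iInf_le_of_le n (iInf_le_of_le c (iInf_le _ ⟨hn, H⟩))).trans ?_
      have hd := realDist_nonneg w (u : V) v
      rw [← ofReal_realDist hr, ← ENNReal.ofReal_mul hγ.le,
        ← ENNReal.ofReal_add (by positivity) (by positivity)]
      refine ENNReal.ofReal_le_ofReal ?_
      have h1 : (c : ℝ) / η ≤ n * (realDist w (u : V) v + t / η) := by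
        rw [div_le_iff₀ hη]
        refine hc.trans (le_of_eq ?_)
        field_simp
      have h2 := mul_le_mul_of_nonneg_right (hn1 n hn)
        (add_nonneg hd htη)
      linarith
    · rw [wdist_eq_top hr, ENNReal.mul_top (by simpa using hγ), top_add]
      exact le_top

end Estimate

end PrivateDist

namespace PrivateDist

/-! ### The joint exponential mechanism for a pair and its value. -/

section Mechanism

/-- A bound for the sums of a two-sided geometric sequence around any centre. -/
noncomputable def geomConst : ℝ≥0∞ :=
  (1 + ENNReal.ofReal (Real.exp (1 / 2))) * (1 - ENNReal.ofReal (Real.exp (-1 / 2)))⁻¹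

lemma geomConst_ne_top : geomConst ≠ ⊤ := by
  refine ENNReal.mul_ne_top (by simp) (ENNReal.inv_ne_top.2 ?_)
  rw [Ne, tsub_eq_zero_iff_le, not_le, ENNReal.ofReal_lt_one, Real.exp_lt_one_iff]
  norm_num

/-- Split at `⌊x⌋₊`: counted downwards, the `i`-th integer below it is at distance at least `i`;
counted upwards, the `j`-th is at distance at least `j - 1`, whence the factor `exp (1 / 2)`. -/
lemma tsum_exp_abs_le (x : ℝ) :
    ∑' z : ℕ, ENNReal.ofReal (Real.exp (-(|(z : ℝ) - x| / 2))) ≤ geomConst := by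
  set ρ := ENNReal.ofReal (Real.exp (-1 / 2)) with hρ
  have hpow : ∀ n : ℕ, ρ ^ n = ENNReal.ofReal (Real.exp (-(n / 2))) := fun n => by
    rw [hρ, ← ENNReal.ofReal_pow (Real.exp_pos _).le, ← Real.exp_nat_mul]
    ring_nf
  set a := ⌊x⌋₊ with ha
  have hxa : x < a + 1 := Nat.lt_floor_add_one x
  rw [← ENNReal.summable.sum_add_tsum_nat_add' (k := a), geomConst, add_mul, one_mul,
    ← ENNReal.tsum_geometric]
  refine add_le_add ?_ ?_
  · rw [← Finset.sum_range_reflect]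
    refine (Finset.sum_le_sum (g := fun i => ρ ^ i) fun i hi => ?_).trans
      (ENNReal.sum_le_tsum _)
    rw [Finset.mem_range] at hi
    have hax : (a : ℝ) ≤ x := Nat.floor_le (by
      by_contra! h
      rw [ha, Nat.floor_of_nonpos h.le] at hi
      omega)
    rw [hpow]
    refine ENNReal.ofReal_le_ofReal (Real.exp_le_exp.2 ?_)
    have hcast : ((a - 1 - i : ℕ) : ℝ) = a - 1 - i := by
      rw [Nat.cast_sub (by omega), Nat.cast_sub (by omega), Nat.cast_one]
    rw [hcast]
    have := neg_le_abs ((a : ℝ) - 1 - i - x)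
    linarith
  · rw [← ENNReal.tsum_mul_left]
    refine ENNReal.tsum_le_tsum fun j => ?_
    rw [hpow, ← ENNReal.ofReal_mul (Real.exp_pos _).le, ← Real.exp_add]
    refine ENNReal.ofReal_le_ofReal (Real.exp_le_exp.2 ?_)
    have := le_abs_self (((j + a : ℕ) : ℝ) - x)
    push_cast at this ⊢
    linarith

variable {A : Type*}

/-- The unnormalized probability of selecting the candidate `y.1` with the recorded value `y.2`. -/
noncomputable def selWeight (U : Set A) (x : A → ℝ) (y : A × ℕ) : ℝ≥0∞ :=
  {y : A × ℕ | y.1 ∈ U}.indicator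
    (fun y => ENNReal.ofReal (Real.exp (-(|(y.2 : ℝ) - x y.1| + x y.1)))) y

lemma selWeight_of_mem {U : Set A} {x : A → ℝ} {y : A × ℕ} (hy : y.1 ∈ U) :
    selWeight U x y = ENNReal.ofReal (Real.exp (-(|(y.2 : ℝ) - x y.1| + x y.1))) :=
  Set.indicator_of_mem (s := {y : A × ℕ | y.1 ∈ U}) hy _

lemma selWeight_of_notMem {U : Set A} {x : A → ℝ} {y : A × ℕ} (hy : y.1 ∉ U) :
    selWeight U x y = 0 :=
  Set.indicator_of_notMem (s := {y : A × ℕ | y.1 ∈ U}) hy _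

lemma tsum_selWeight_ne_zero {U : Set A} (hU : U.Nonempty) (x : A → ℝ) :
    ∑' y, selWeight U x y ≠ 0 := by
  obtain ⟨a, ha⟩ := hU
  intro h
  have := ENNReal.tsum_eq_zero.1 h (a, 0)
  rw [selWeight_of_mem ha, ENNReal.ofReal_eq_zero] at this
  exact absurd (Real.exp_pos _) (not_lt.2 this)

lemma tsum_prod_le [Fintype A] (f : A × ℕ → ℝ≥0∞) (c x : A → ℝ)
    (hf : ∀ a z, f (a, z) ≤ ENNReal.ofReal (Real.exp (c a))
      * ENNReal.ofReal (Real.exp (-(|(z : ℝ) - x a| / 2)))) :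
    ∑' y, f y ≤ ∑ a, ENNReal.ofReal (Real.exp (c a)) * geomConst := by
  rw [ENNReal.tsum_prod', tsum_fintype]
  refine Finset.sum_le_sum fun a _ => ?_
  refine (ENNReal.tsum_le_tsum (hf a)).trans ?_
  rw [ENNReal.tsum_mul_left]
  exact mul_le_mul_right (tsum_exp_abs_le _) _

lemma tsum_selWeight_ne_top [Fintype A] (U : Set A) (x : A → ℝ) :
    ∑' y, selWeight U x y ≠ ⊤ := by
  refine ne_top_of_le_ne_top (ENNReal.sum_ne_top.2 fun a _ =>
    ENNReal.mul_ne_top ENNReal.ofReal_ne_top geomConst_ne_top)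
    (tsum_prod_le _ (fun a => -x a) x fun a z => ?_)
  by_cases ha : a ∈ U
  · rw [selWeight_of_mem (y := (a, z)) ha, ← ENNReal.ofReal_mul (Real.exp_pos _).le,
      ← Real.exp_add]
    refine ENNReal.ofReal_le_ofReal (Real.exp_le_exp.2 ?_)
    have := abs_nonneg ((z : ℝ) - x a)
    simp only
    linarith
  · rw [selWeight_of_notMem (y := (a, z)) ha]
    exact bot_le

/-- The exponential mechanism that jointly selects a candidate of nearly minimal value and
releases an approximation of that value. -/
noncomputable def select [Fintype A] (U : Set A) (hU : U.Nonempty) (x : A → ℝ) : PMF (A × ℕ) :=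
  PMF.normalize (selWeight U x) (tsum_selWeight_ne_zero hU x) (tsum_selWeight_ne_top U x)

/-- The score `|z - x| + x` is `2`-Lipschitz in `x`. The normalizing constant costs the same factor
again in `select_le`. -/
lemma selWeight_le {U : Set A} {x x' : A → ℝ} {η : ℝ} (h : ∀ a ∈ U, |x a - x' a| ≤ η)
    (y : A × ℕ) : selWeight U x y ≤ ENNReal.ofReal (Real.exp (2 * η)) * selWeight U x' y := by
  by_cases hy : y.1 ∈ U
  · rw [selWeight_of_mem hy, selWeight_of_mem hy, ← ENNReal.ofReal_mul (Real.exp_pos _).le,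
      ← Real.exp_add]
    refine ENNReal.ofReal_le_ofReal (Real.exp_le_exp.2 ?_)
    have h1 := h _ hy
    have h2 := abs_sub_le ((y.2 : ℝ)) (x y.1) (x' y.1)
    have h3 := neg_le_abs (x y.1 - x' y.1)
    linarith
  · rw [selWeight_of_notMem hy]
    exact bot_le

lemma select_le [Fintype A] {U : Set A} (hU : U.Nonempty) {x x' : A → ℝ} {η : ℝ}
    (h : ∀ a ∈ U, |x a - x' a| ≤ η) (y : A × ℕ) :
    select U hU x y ≤ ENNReal.ofReal (Real.exp (4 * η)) * select U hU x' y := by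
  have h' : ∀ a ∈ U, |x' a - x a| ≤ η := fun a ha => by rw [abs_sub_comm]; exact h a ha
  have hN : ∑' y, selWeight U x' y
      ≤ ENNReal.ofReal (Real.exp (2 * η)) * ∑' y, selWeight U x y := by
    rw [← ENNReal.tsum_mul_left]
    exact ENNReal.tsum_le_tsum (selWeight_le h')
  have hc0 : ENNReal.ofReal (Real.exp (2 * η)) ≠ 0 := by simp [Real.exp_pos]
  have hinv : (∑' y, selWeight U x y)⁻¹
      ≤ ENNReal.ofReal (Real.exp (2 * η)) * (∑' y, selWeight U x' y)⁻¹ := by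
    have := ENNReal.inv_le_inv.2 hN
    rw [ENNReal.mul_inv (.inl hc0) (.inl ENNReal.ofReal_ne_top)] at this
    calc (∑' y, selWeight U x y)⁻¹
        = ENNReal.ofReal (Real.exp (2 * η)) *
          ((ENNReal.ofReal (Real.exp (2 * η)))⁻¹ * (∑' y, selWeight U x y)⁻¹) := by
          rw [← mul_assoc, ENNReal.mul_inv_cancel hc0 ENNReal.ofReal_ne_top, one_mul]
      _ ≤ _ := mul_le_mul_right this _
  rw [select, select, PMF.normalize_apply, PMF.normalize_apply]
  refine (mul_le_mul' (selWeight_le h y) hinv).trans (le_of_eq ?_)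
  rw [show (4 : ℝ) * η = 2 * η + 2 * η by ring, Real.exp_add, ENNReal.ofReal_mul (Real.exp_pos _).le]
  ring

lemma measurable_select [Fintype A] {W : Type*} [MeasurableSpace W] {U : Set A} (hU : U.Nonempty)
    {x : W → A → ℝ} (hx : ∀ a ∈ U, Measurable fun w => x w a) (y : A × ℕ) :
    Measurable fun w => select U hU (x w) y := by
  have hw : ∀ y, Measurable fun w => selWeight U (x w) y := by
    intro y
    by_cases hy : y.1 ∈ U
    · simp only [selWeight_of_mem hy]
      have := hx _ hy
      refine ENNReal.measurable_ofReal.comp (Real.measurable_exp.comp ?_)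
      exact ((measurable_const.sub this).abs.add this).neg
    · simp only [selWeight_of_notMem hy]
      exact measurable_const
  simp only [select, PMF.normalize_apply]
  exact (hw y).mul (Measurable.tsum hw).inv

/-- A bad outcome has a score at least `t` above the minimum `x f`, while `(f, ⌊x f⌋₊)` has score at
most `x f + 1`. Half of the excess gives `exp (-t / 2)`; the other half leaves `|z - x a| / 2` to
make the sum over `z` converge. -/
lemma select_bad_le [Fintype A] {U : Set A} (hU : U.Nonempty) {x : A → ℝ} (hx : ∀ a, 0 ≤ x a)
    (t : ℝ) :
    (select U hU x).toOuterMeasure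
      {y | ¬ (y.1 ∈ U ∧ (∀ f ∈ U, (y.2 : ℝ) ≤ x f + t) ∧ x y.1 ≤ y.2 + t)}
      ≤ Fintype.card A * (geomConst * ENNReal.ofReal (Real.exp (1 - t / 2))) := by
  obtain ⟨f, hf, hmin⟩ := Set.exists_min_image U x (Set.toFinite _) hU
  have hN : ENNReal.ofReal (Real.exp (-(1 + x f))) ≤ ∑' y, selWeight U x y := by
    refine le_trans ?_ (ENNReal.le_tsum (f, ⌊x f⌋₊))
    rw [selWeight_of_mem (y := (f, ⌊x f⌋₊)) hf]
    refine ENNReal.ofReal_le_ofReal (Real.exp_le_exp.2 ?_)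
    have h1 := Nat.floor_le (hx f)
    have h2 := Nat.lt_floor_add_one (x f)
    have : |(⌊x f⌋₊ : ℝ) - x f| ≤ 1 := abs_le.2 ⟨by linarith, by linarith⟩
    simp only
    linarith
  have hnum := tsum_prod_le (fun y =>
    {y : A × ℕ | ¬ (y.1 ∈ U ∧ (∀ f ∈ U, (y.2 : ℝ) ≤ x f + t) ∧ x y.1 ≤ y.2 + t)}.indicator
      (selWeight U x) y) (fun _ => -(x f) - t / 2) x (fun a z => by
    by_cases ha : a ∈ U
    · refine Set.indicator_apply_le' (fun hbad => ?_) fun _ => bot_le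
      rw [selWeight_of_mem (y := (a, z)) ha, ← ENNReal.ofReal_mul (Real.exp_pos _).le,
        ← Real.exp_add]
      refine ENNReal.ofReal_le_ofReal (Real.exp_le_exp.2 ?_)
      simp only
      have hfa := hmin a ha
      have hscore : x f + t ≤ |(z : ℝ) - x a| + x a := by
        by_contra! hlt
        refine hbad ⟨ha, fun g hg => ?_, ?_⟩
        · have := hmin g hg
          have := le_abs_self ((z : ℝ) - x a)
          simp only
          linarith
        · have := neg_le_abs ((z : ℝ) - x a)
          simp only
          linarith
      linarith
    · refine Set.indicator_apply_le' (fun _ => ?_) fun _ => bot_le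
      rw [selWeight_of_notMem (y := (a, z)) ha]
      exact bot_le)
  rw [PMF.toOuterMeasure_apply]
  have hsel : ∀ B : Set (A × ℕ), ∀ y, B.indicator (select U hU x) y
      = B.indicator (selWeight U x) y * (∑' y, selWeight U x y)⁻¹ := by
    intro B y
    by_cases hy : y ∈ B <;> simp [hy, select, PMF.normalize_apply]
  simp only [hsel, ENNReal.tsum_mul_right]
  refine (mul_le_mul' hnum (ENNReal.inv_le_inv.2 hN)).trans (le_of_eq ?_)
  rw [Finset.sum_const, Finset.card_univ, nsmul_eq_mul, ← ENNReal.ofReal_inv_of_pos (Real.exp_pos _),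
    ← Real.exp_neg, show (1 : ℝ) - t / 2 = (-(x f) - t / 2) + -(-(1 + x f)) by ring, Real.exp_add,
    ENNReal.ofReal_mul (Real.exp_pos _).le]
  ring

end Mechanism

/-! ### Iterated selection. -/

section Run

variable {σ : Type*} [Fintype σ]

open Classical in
/-- Repeatedly select an uncovered pair of nearly minimal value, at most `n` times. -/
noncomputable def run (R : σ × σ → Prop) (k : ℕ) (x : σ × σ → ℝ) :
    ℕ → List ((σ × σ) × ℕ) → PMF (List ((σ × σ) × ℕ))
  | 0, h => PMF.pure h
  | n + 1, h =>
    if hU : (uncovered R k h).Nonempty then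
      (select (uncovered R k h) hU x).bind fun y => run R k x n (y :: h)
    else PMF.pure h

variable {R : σ × σ → Prop} {k : ℕ}

lemma measurable_run {W : Type*} [MeasurableSpace W] {x : W → σ × σ → ℝ}
    (hx : ∀ a, R a → Measurable fun w => x w a) (n : ℕ) (h l : List ((σ × σ) × ℕ)) :
    Measurable fun w => run R k (x w) n h l := by
  induction n generalizing h with
  | zero => simp only [run]; exact measurable_const
  | succ n ih =>
    by_cases hU : (uncovered R k h).Nonempty
    · simp only [run, hU, dif_pos, PMF.bind_apply]
      exact Measurable.tsum fun y =>
        (measurable_select hU (fun a ha => hx a ha.1) y).mul (ih _)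
    · simp only [run, hU, dif_neg, not_false_eq_true]
      exact measurable_const

lemma momentClose_run {x x' : σ × σ → ℝ} {q : ℝ} (hq : 1 ≤ q) {a : ℝ≥0∞} (ha : 1 ≤ a)
    (hstep : ∀ (U : Set (σ × σ)) (hU : U.Nonempty), (∀ e ∈ U, R e) →
      MomentClose q a (select U hU x) (select U hU x')) (n : ℕ) (h : List ((σ × σ) × ℕ)) :
    MomentClose q (a ^ n) (run R k x n h) (run R k x' n h) := by
  induction n generalizing h with
  | zero => simpa only [run, pow_zero] using momentClose_self_pure hq le_rfl h
  | succ n ih =>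
    by_cases hU : (uncovered R k h).Nonempty
    · simp only [run, hU, dif_pos, pow_succ']
      exact (hstep _ hU fun e he => he.1).bind hq fun y => ih _
    · simp only [run, hU, dif_neg, not_false_eq_true]
      exact momentClose_self_pure hq (one_le_pow₀ ha) h

/-- A union bound over the steps. A run without bad selections ends either because nothing is
uncovered or because all `n` steps were used. -/
lemma run_bad_le {x : σ × σ → ℝ} (hx : ∀ a, 0 ≤ x a) (t : ℝ) (n : ℕ)
    (h : List ((σ × σ) × ℕ)) (hG : Good R k x t h) :
    (run R k x n h).toOuterMeasure
      {l | ¬ (Good R k x t l ∧ (uncovered R k l = ∅ ∨ l.length = h.length + n))}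
      ≤ n * (Fintype.card (σ × σ) * (geomConst * ENNReal.ofReal (Real.exp (1 - t / 2)))) := by
  set β : ℝ≥0∞ := Fintype.card (σ × σ) * (geomConst * ENNReal.ofReal (Real.exp (1 - t / 2)))
  have hpure : ∀ (h) (B : Set (List ((σ × σ) × ℕ))), h ∉ B → ∀ c : ℝ≥0∞,
      (PMF.pure h).toOuterMeasure B ≤ c := by
    intro h B hB c
    rw [← mean_indicator, mean_pure, Set.indicator_of_notMem hB]
    exact bot_le
  induction n generalizing h with
  | zero =>
    simp only [run]
    exact hpure h _ (by simpa using hG) _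
  | succ n ih =>
    by_cases hU : (uncovered R k h).Nonempty
    · simp only [run, hU, dif_pos]
      set Bad : Set ((σ × σ) × ℕ) := {y | ¬ (y.1 ∈ uncovered R k h ∧
        (∀ f ∈ uncovered R k h, (y.2 : ℝ) ≤ x f + t) ∧ x y.1 ≤ y.2 + t)} with hBad
      rw [← mean_indicator, mean_bind]
      have hone : ∀ P : PMF ((σ × σ) × ℕ), ∀ c : ℝ≥0∞, ∑' y, P y * c = c := fun P c => by
        rw [ENNReal.tsum_mul_right, P.tsum_coe, one_mul]
      calc mean (select (uncovered R k h) hU x) _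
          ≤ mean (select (uncovered R k h) hU x) (fun y => Bad.indicator 1 y + n * β) := by
            refine mean_mono _ fun y => ?_
            rw [mean_indicator]
            by_cases hy : y ∈ Bad
            · rw [Set.indicator_of_mem hy]
              refine le_trans ?_ le_self_add
              rw [PMF.toOuterMeasure_apply, Pi.one_apply,
                ← (run R k x n (y :: h)).tsum_coe]
              exact ENNReal.tsum_le_tsum fun l => Set.indicator_le_self _ _ _
            · have hgood : Good R k x t (y :: h) := ⟨hG, not_not.1 hy⟩
              have := ih (y :: h) hgood
              rw [List.length_cons, add_assoc, add_comm 1 n] at this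
              exact this.trans le_add_self
        _ = (select (uncovered R k h) hU x).toOuterMeasure Bad + n * β := by
            simp only [mean, mul_add, ENNReal.tsum_add, hone]
            rw [← mean_indicator, mean]
        _ ≤ β + n * β := by
            gcongr
            exact select_bad_le hU hx t
        _ = _ := by push_cast; ring
    · simp only [run, hU, dif_neg, not_false_eq_true]
      refine hpure h _ ?_ _
      exact not_not.2 ⟨hG, .inl (Set.not_nonempty_iff_eq_empty.1 hU)⟩

end Run

end PrivateDist

namespace PrivateDist

/-! ### Privacy and accuracy of the released estimates. -/

section Release

variable {V : Type*} {G : SimpleGraph V}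

/-- The scaled distances between the pairs of terminals. -/
noncomputable def scaledDist (S : Finset V) (η : ℝ) (w : G.edgeSet → ℝ≥0) (e : S × S) : ℝ :=
  η * realDist w (e.1 : V) e.2

variable (G) in
/-- The pairs of terminals that are joined by a path. -/
def Linked (S : Finset V) (e : S × S) : Prop := G.Reachable (e.1 : V) e.2

variable [Fintype G.edgeSet]

variable (G) in
/-- The private algorithm: record `m` selected links, and release the resulting estimates. -/
noncomputable def release (S : Finset V) (k m : ℕ) (η : ℝ) :
    Kernel (G.edgeSet → ℝ≥0) (S → S → ℝ≥0∞) where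
  toFun w := ((run (Linked G S) k (scaledDist S η w) m []).map (estimate k η)).toMeasure
  measurable' := by
    refine Measure.measurable_of_measurable_coe _ fun T hT => ?_
    have happly : ∀ P : PMF (List ((S × S) × ℕ)), (P.map (estimate k η)).toMeasure T
        = ∑' l, (estimate k η ⁻¹' T).indicator P l := fun P => by
      rw [PMF.toMeasure_apply_eq_toOuterMeasure_apply _ hT, PMF.toOuterMeasure_map_apply,
        PMF.toOuterMeasure_apply]
    simp only [happly]
    refine Measurable.tsum fun l => ?_
    by_cases hl : l ∈ estimate k η ⁻¹' T
    · simp only [Set.indicator_of_mem hl]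
      exact measurable_run (fun a ha => (measurable_realDist ha).const_mul η) m [] l
    · simp only [Set.indicator_of_notMem hl]
      exact measurable_const

lemma release_eq (S : Finset V) (k m : ℕ) (η : ℝ) (w : G.edgeSet → ℝ≥0) :
    release G S k m η w
      = ((run (Linked G S) k (scaledDist S η w) m []).map (estimate k η)).toMeasure := rfl

lemma release_apply (S : Finset V) (k m : ℕ) (η : ℝ) (w : G.edgeSet → ℝ≥0)
    {T : Set (S → S → ℝ≥0∞)} (hT : MeasurableSet T) : release G S k m η w T
      = (run (Linked G S) k (scaledDist S η w) m []).toOuterMeasure (estimate k η ⁻¹' T) := by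
  rw [release_eq, PMF.toMeasure_apply_eq_toOuterMeasure_apply _ hT, PMF.toOuterMeasure_map_apply]

instance (S : Finset V) (k m : ℕ) (η : ℝ) : IsMarkovKernel (release G S k m η) :=
  ⟨fun w => by rw [release_eq]; infer_instance⟩

lemma abs_scaledDist_sub_le {S : Finset V} {η : ℝ} (hη : 0 ≤ η) {w w' : G.edgeSet → ℝ≥0}
    (h : Neighboring w w') {e : S × S} (he : Linked G S e) :
    |scaledDist S η w e - scaledDist S η w' e| ≤ η := by
  rw [scaledDist, scaledDist, ← mul_sub, abs_mul, abs_of_nonneg hη]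
  exact mul_le_of_le_one_right hη ((abs_realDist_sub_le w w' he).trans h)

lemma isDP_release (S : Finset V) (k m : ℕ) {ε δ : ℝ} (hm : 1 ≤ m) (hε : 0 < ε) (hε1 : ε < 1)
    (hδ : 0 < δ) (hδ1 : δ < 1) :
    IsDP ε δ (release G S k m (ε / (16 * Real.sqrt (m * Real.log (2 / δ))))) := by
  intro w w' hw T hT
  rw [release_apply _ _ _ _ _ hT, release_apply _ _ _ _ _ hT]
  set L := Real.log (2 / δ) with hLdef
  have hL : 0.69 < L := by
    have h1 := Real.log_two_gt_d9
    have h2 : Real.log 2 < L := Real.log_lt_log (by norm_num) (by rw [lt_div_iff₀ hδ]; linarith)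
    linarith
  have hm' : (1 : ℝ) ≤ m := by exact_mod_cast hm
  set r := Real.sqrt (m * L) with hr
  have hr2 : r ^ 2 = m * L := Real.sq_sqrt (by positivity)
  have hr0 : 0 < r := Real.sqrt_pos.2 (by positivity)
  set η := ε / (16 * r) with hηdef
  have hη : 0 < η := by positivity
  have hw' : Neighboring w' w := by
    simpa only [Neighboring, abs_sub_comm] using hw
  have hθ : 4 * η = ε / (4 * r) := by rw [hηdef]; field_simp; norm_num
  have hsel : ∀ (U : Set (S × S)) (hU : U.Nonempty), (∀ e ∈ U, Linked G S e) → ∀ y,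
      select U hU (scaledDist S η w) y
        ≤ ENNReal.ofReal (Real.exp (4 * η)) * select U hU (scaledDist S η w') y :=
    fun U hU hL y => select_le hU (fun a ha => abs_scaledDist_sub_le hη.le hw (hL a ha)) y
  have hsel' : ∀ (U : Set (S × S)) (hU : U.Nonempty), (∀ e ∈ U, Linked G S e) → ∀ y,
      select U hU (scaledDist S η w') y
        ≤ ENNReal.ofReal (Real.exp (4 * η)) * select U hU (scaledDist S η w) y :=
    fun U hU hL y => select_le hU (fun a ha => abs_scaledDist_sub_le hη.le hw' (hL a ha)) y
  rcases le_or_gt L m with hLm | hLm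
  -- With `θ = 4 * η = ε / (4 * r)`, this `α` gives `m * α ^ 2 * θ ^ 2 = L`, so the additive term is
  -- `exp (ε - 3 * L) ≤ exp (-L) = δ / 2`. The constraint `α * θ ≤ 1` reads `L ≤ r`, that is, `L ≤
  -- m`.
  · set α := 4 * L / ε with hα
    have hα1 : 1 < α := by rw [hα, lt_div_iff₀ hε]; linarith
    have hconj := Real.HolderConjugate.conjExponent hα1
    have hLr : L ≤ r := by
      rw [hr]
      refine Real.le_sqrt_of_sq_le ?_
      rw [sq]
      exact mul_le_mul_of_nonneg_right hLm (by linarith)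
    have hαθ : α * (4 * η) ≤ 1 := by
      rw [hθ, hα, show 4 * L / ε * (ε / (4 * r)) = L / r by field_simp, div_le_one hr0]
      exact hLr
    have hstep := fun (U : Set (S × S)) (hU : U.Nonempty) (hUL : ∀ e ∈ U, Linked G S e) =>
      momentClose_of_ratio hconj hαθ (hsel U hU hUL) (hsel' U hU hUL)
    have hrun := momentClose_run (k := k) hconj.symm.lt.le
      (ENNReal.one_le_ofReal.2 (Real.one_le_exp (by positivity))) hstep m []
    rw [← ENNReal.ofReal_pow (Real.exp_pos _).le, ← Real.exp_nat_mul] at hrun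
    refine (hrun.outer_le (ε := ε) hconj _).trans (add_le_add le_rfl ?_)
    refine ENNReal.ofReal_le_ofReal ?_
    have hexp : α * (m * (α * (4 * η) ^ 2)) - (α - 1) * ε = ε - 3 * L := by
      have : α * (m * (α * (4 * η) ^ 2)) = L := by
        rw [hθ, hα]
        have : (ε / (4 * r)) ^ 2 = ε ^ 2 / (16 * (m * L)) := by rw [div_pow, mul_pow, hr2]; norm_num
        rw [this]
        field_simp
        norm_num
      have h2 : α * ε = 4 * L := by rw [hα]; field_simp
      rw [this, sub_mul, h2]
      ring
    rw [hexp]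
    calc Real.exp (ε - 3 * L) ≤ Real.exp (-L) := Real.exp_le_exp.2 (by linarith)
      _ = δ / 2 := by rw [Real.exp_neg, hLdef, Real.exp_log (by positivity), inv_div]
      _ ≤ δ := by linarith
  -- When `m < L`, also `m ≤ r`, and basic composition already gives pure `ε`-privacy.
  · have hstep := fun (U : Set (S × S)) (hU : U.Nonempty) (hUL : ∀ e ∈ U, Linked G S e) =>
      momentClose_one (hsel U hU hUL)
    have hrun := momentClose_run (k := k) le_rfl
      (ENNReal.one_le_ofReal.2 (Real.one_le_exp (by positivity))) hstep m []
      ((estimate k η ⁻¹' T).indicator 1)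
    simp only [div_one, ENNReal.rpow_one] at hrun
    rw [mean_indicator, mean_indicator,
      ← ENNReal.ofReal_pow (Real.exp_pos _).le, ← Real.exp_nat_mul] at hrun
    refine hrun.trans (le_trans ?_ le_self_add)
    refine mul_le_mul_left (ENNReal.ofReal_le_ofReal (Real.exp_le_exp.2 ?_)) _
    have hmr : (m : ℝ) ≤ r := by
      rw [hr]
      refine Real.le_sqrt_of_sq_le ?_
      rw [sq]
      exact mul_le_mul_of_nonneg_left hLm.le (by linarith)
    rw [hθ, ← mul_div_assoc, div_le_iff₀ (by positivity)]
    nlinarith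

lemma release_not_isAccurate_le (S : Finset V) {k m : ℕ} (hk : 1 ≤ k) {η t c : ℝ}
    (hη : 0 < η) (ht : 0 ≤ t) (hc : 0 ≤ c) (hS : (S.card : ℝ) ≤ c ^ k)
    (hm : c * S.card < m) (w : G.edgeSet → ℝ≥0) :
    1 - m * (S.card ^ 2 * (geomConst.toReal * Real.exp (1 - t / 2))) ≤
      (release G S k m η w).real
        {est | IsAccurate w S (2 * (k : ℝ) - 1) ((2 * k - 1) * (t / η)) est} := by
  set P := run (Linked G S) k (scaledDist S η w) m [] with hP
  set B : Set (List ((S × S) × ℕ)) := {l | ¬ (Good (Linked G S) k (scaledDist S η w) t l ∧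
      (uncovered (Linked G S) k l = ∅ ∨ l.length = ([] : List ((S × S) × ℕ)).length + m))} with hB
  set Acc := {est | IsAccurate w S (2 * (k : ℝ) - 1) ((2 * k - 1) * (t / η)) est} with hAcc
  have hbad : P.toOuterMeasure B ≤ _ :=
    run_bad_le (R := Linked G S) (k := k) (x := scaledDist S η w)
    (fun a => mul_nonneg hη.le (realDist_nonneg _ _ _)) t m [] trivial
  have hsub : Bᶜ ⊆ estimate k η ⁻¹' Acc := by
    intro l hl
    obtain ⟨hG, hl⟩ := not_not.1 hl
    -- A good run cannot use all `m` steps: by the girth bound it has at most `c * |S| < m` links.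
    -- So it stopped with nothing uncovered.
    refine isAccurate_estimate hk hη ht hG (hl.resolve_right fun hlen => ?_)
    have := hG.length_le hk hc (by rwa [Fintype.card_coe])
    rw [Fintype.card_coe, hlen, List.length_nil, zero_add] at this
    linarith
  have hone : (1 : ℝ≥0∞) ≤ release G S k m η w Acc + P.toOuterMeasure B := by
    calc (1 : ℝ≥0∞) = P.toOuterMeasure (estimate k η ⁻¹' Acc ∪ B) := by
          rw [show estimate k η ⁻¹' Acc ∪ B = Set.univ from ?_, ← mean_indicator,
            Set.indicator_univ]
          · simp [mean, P.tsum_coe]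
          · refine Set.eq_univ_of_forall fun l => ?_
            by_cases hl : l ∈ B
            · exact .inr hl
            · exact .inl (hsub hl)
      _ ≤ P.toOuterMeasure (estimate k η ⁻¹' Acc) + P.toOuterMeasure B := measure_union_le _ _
      _ ≤ _ := by
          gcongr
          rw [release_eq, ← PMF.toOuterMeasure_map_apply]
          exact PMF.toOuterMeasure_apply_le_toMeasure_apply _ _
  have hfin : (m : ℝ≥0∞) * (Fintype.card (S × S) *
      (geomConst * ENNReal.ofReal (Real.exp (1 - t / 2)))) ≠ ⊤ :=
    ENNReal.mul_ne_top (ENNReal.natCast_ne_top _) (ENNReal.mul_ne_top (ENNReal.natCast_ne_top _)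
      (ENNReal.mul_ne_top geomConst_ne_top (by simp)))
  have hle := hone.trans (add_le_add le_rfl hbad)
  have hle' := ENNReal.toReal_mono (ENNReal.add_ne_top.2 ⟨measure_ne_top _ _, hfin⟩) hle
  rw [ENNReal.toReal_add (measure_ne_top _ _) hfin, ENNReal.toReal_one, ENNReal.toReal_mul,
    ENNReal.toReal_mul, ENNReal.toReal_mul, ENNReal.toReal_natCast, ENNReal.toReal_natCast,
    ENNReal.toReal_ofReal (Real.exp_pos _).le, Fintype.card_prod, Fintype.card_coe] at hle'
  push_cast at hle'
  rw [Measure.real, sq]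
  linarith

end Release

lemma IsAccurate.mono {V : Type*} {G : SimpleGraph V} {w : G.edgeSet → ℝ≥0} {S : Finset V}
    {γ α α' : ℝ} {est : S → S → ℝ≥0∞} (h : IsAccurate w S γ α est) (hα : α ≤ α') :
    IsAccurate w S γ α' est := fun u v =>
  ⟨(h u v).1.trans (add_le_add le_rfl (ENNReal.ofReal_le_ofReal hα)),
    (h u v).2.trans (add_le_add le_rfl (ENNReal.ofReal_le_ofReal hα))⟩

lemma isDP_const {E Ω : Type*} [Fintype E] [MeasurableSpace Ω] {ε : ℝ} (hε : 0 ≤ ε) (δ : ℝ)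
    (μ : Measure Ω) : IsDP ε δ (Kernel.const (E → ℝ≥0) μ) := by
  intro w w' _ T _
  rw [Kernel.const_apply, Kernel.const_apply]
  refine le_trans ?_ le_self_add
  exact le_mul_of_one_le_left' (ENNReal.one_le_ofReal.2 (Real.one_le_exp hε))

lemma error_le {n s k m : ℕ} {ε L : ℝ} (hn : 2 ≤ n) (hk : 1 ≤ k) (hε : 0 < ε) (hL : 0 ≤ L)
    (hm : (m : ℝ) ≤ 2 * (s : ℝ) ^ (1 + 1 / (k : ℝ))) :
    (2 * (k : ℝ) - 1) * (10 * Real.log n / (ε / (16 * Real.sqrt (m * L))))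
      ≤ 1280 * ((k : ℝ) ^ (3 / 2 : ℝ) * Real.log n ^ (3 / 2 : ℝ) *
        Real.sqrt ((s : ℝ) ^ (1 + 1 / (k : ℝ)) * L) / ε) := by
  have hk' : (1 : ℝ) ≤ k := by exact_mod_cast hk
  have hlog : 0.69 < Real.log n := by
    have h1 := Real.log_two_gt_d9
    have h2 : Real.log 2 ≤ Real.log n := Real.log_le_log (by norm_num) (by exact_mod_cast hn)
    linarith
  set ℓ := Real.log n
  set Q := (s : ℝ) ^ (1 + 1 / (k : ℝ)) with hQ
  have hQ0 : 0 ≤ Q := by positivity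
  have hsqrt : Real.sqrt (m * L) ≤ 2 * Real.sqrt (Q * L) := by
    refine Real.sqrt_le_iff.2 ⟨by positivity, ?_⟩
    rw [mul_pow, Real.sq_sqrt (by positivity)]
    nlinarith [mul_le_mul_of_nonneg_right hm hL, mul_nonneg hQ0 hL]
  have hkk : (k : ℝ) ≤ (k : ℝ) ^ (3 / 2 : ℝ) := by
    simpa using Real.rpow_le_rpow_of_exponent_le hk' (show (1 : ℝ) ≤ 3 / 2 by norm_num)
  have hll : ℓ ≤ 2 * ℓ ^ (3 / 2 : ℝ) := by
    have hsq : 1 / 2 ≤ Real.sqrt ℓ := Real.le_sqrt_of_sq_le (by linarith)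
    rw [show (3 / 2 : ℝ) = 1 + 1 / 2 by norm_num, Real.rpow_add (by linarith), Real.rpow_one,
      ← Real.sqrt_eq_rpow]
    nlinarith
  have hl0 : 0 ≤ ℓ := by linarith
  calc (2 * (k : ℝ) - 1) * (10 * ℓ / (ε / (16 * Real.sqrt (m * L))))
      = 160 * ((2 * (k : ℝ) - 1) * ℓ * Real.sqrt (m * L) / ε) := by
        rw [div_div_eq_mul_div]; ring
    _ ≤ 160 * ((2 * (k : ℝ) ^ (3 / 2 : ℝ)) * (2 * ℓ ^ (3 / 2 : ℝ)) *
          (2 * Real.sqrt (Q * L)) / ε) := by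
        gcongr
        linarith
    _ = _ := by ring

/-- The choice `t = 10 * log n` makes `exp (-t / 2) = n ^ (-5)`, which beats the union bound over at
most `2 * n ^ 4` events. -/
lemma failure_le {n s m : ℕ} {K p : ℝ} (hn : 2 ≤ n) (hK : 0 ≤ K) (hs : 1 ≤ s) (hsn : s ≤ n)
    (hp : p ≤ 2) (hm : (m : ℝ) ≤ 2 * (s : ℝ) ^ p) :
    m * (s ^ 2 * (K * Real.exp (1 - 10 * Real.log n / 2))) ≤ 2 * K * Real.exp 1 / n := by
  have hn0 : (0 : ℝ) < n := by exact_mod_cast (by omega : 0 < n)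
  have hsn' : (s : ℝ) ≤ n := by exact_mod_cast hsn
  have hs' : (1 : ℝ) ≤ s := by exact_mod_cast hs
  have hexp : Real.exp (1 - 10 * Real.log n / 2) = Real.exp 1 / (n : ℝ) ^ 5 := by
    rw [Real.exp_sub, show 10 * Real.log n / 2 = (5 : ℕ) * Real.log n by push_cast; ring,
      Real.exp_nat_mul, Real.exp_log hn0]
  have hm2 : (m : ℝ) ≤ 2 * (n : ℝ) ^ 2 := by
    have h1 : (s : ℝ) ^ p ≤ (s : ℝ) ^ (2 : ℝ) := Real.rpow_le_rpow_of_exponent_le hs' hp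
    rw [Real.rpow_two] at h1
    have h2 : (s : ℝ) ^ 2 ≤ (n : ℝ) ^ 2 := by gcongr
    linarith
  rw [hexp]
  calc (m : ℝ) * (s ^ 2 * (K * (Real.exp 1 / (n : ℝ) ^ 5)))
      ≤ (2 * (n : ℝ) ^ 2) * ((n : ℝ) ^ 2 * (K * (Real.exp 1 / (n : ℝ) ^ 5))) := by gcongr
    _ = _ := by field_simp

end PrivateDist

theorem mainTheorem8 :
    ∃ C₁ : ℝ, 0 < C₁ ∧ ∃ C₂ : ℝ, 0 < C₂ ∧
      ∀ (V : Type*) [Fintype V] (G : SimpleGraph V) [Fintype G.edgeSet] (S : Finset V)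
        (k : ℕ) (ε δ : ℝ), 1 ≤ k → 0 < ε → ε < 1 → 0 < δ → δ < 1 →
        ∃ M : Kernel (G.edgeSet → ℝ≥0) (S → S → ℝ≥0∞),
          IsMarkovKernel M ∧ PrivateDist.IsDP ε δ M ∧
          ∀ w : G.edgeSet → ℝ≥0,
            1 - C₂ / (Fintype.card V : ℝ) ≤
              (M w).real {est | PrivateDist.IsAccurate w S (2 * (k : ℝ) - 1)
                (C₁ * ((k : ℝ) ^ (3 / 2 : ℝ) * Real.log (Fintype.card V : ℝ) ^ (3 / 2 : ℝ) *
                  Real.sqrt ((S.card : ℝ) ^ (1 + 1 / (k : ℝ)) * Real.log (2 / δ)) / ε)) est} := by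
  have hK : 0 ≤ PrivateDist.geomConst.toReal := ENNReal.toReal_nonneg
  -- `1280 = 10 * 16 * 8`, from `t`, from `η`, and from the three factors `2` lost in `error_le`.
  -- The summand `1` makes the probability claim trivial for one vertex.
  refine ⟨1280, by norm_num, 2 * PrivateDist.geomConst.toReal * Real.exp 1 + 1, by positivity, ?_⟩
  intro V _ G _ S k ε δ hk hε hε1 hδ hδ1
  rcases S.eq_empty_or_nonempty with rfl | hS
  · refine ⟨Kernel.const _ (Measure.dirac fun _ _ => 0), inferInstance,
      PrivateDist.isDP_const hε.le δ _, fun w => ?_⟩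
    rw [show {est | PrivateDist.IsAccurate w ∅ _ _ est} = Set.univ from
      Set.eq_univ_of_forall fun est u => absurd u.2 (Finset.notMem_empty _)]
    simp only [Kernel.const_apply, probReal_univ, tsub_le_iff_right, le_add_iff_nonneg_right]
    positivity
  rcases Nat.lt_or_ge (Fintype.card V) 2 with hV | hV
  · refine ⟨Kernel.const _ (Measure.dirac fun _ _ => 0), inferInstance,
      PrivateDist.isDP_const hε.le δ _, fun w => le_trans ?_ measureReal_nonneg⟩
    have : 0 < Fintype.card V := Fintype.card_pos_iff.2 ⟨hS.choose⟩
    rw [show Fintype.card V = 1 by omega, Nat.cast_one, div_one]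
    have := Real.exp_pos 1
    nlinarith [mul_nonneg hK this.le]
  have hs : 1 ≤ S.card := hS.card_pos
  have hs' : (1 : ℝ) ≤ S.card := by exact_mod_cast hs
  have hk' : (1 : ℝ) ≤ k := by exact_mod_cast hk
  set p : ℝ := 1 + 1 / (k : ℝ) with hp
  have hp2 : p ≤ 2 := by
    have : 1 / (k : ℝ) ≤ 1 := by rw [div_le_one (by linarith)]; exact hk'
    linarith
  have hp1 : 0 ≤ p := by positivity
  have hQ : 1 ≤ (S.card : ℝ) ^ p := Real.one_le_rpow hs' hp1
  -- Strictly more than `|S| ^ (1 + 1/k) = c * |S|` for `c = |S| ^ (1/k)`, so that a good run cannot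
  -- exhaust its steps.
  set m : ℕ := ⌊(S.card : ℝ) ^ p⌋₊ + 1 with hmdef
  have hm_gt : (S.card : ℝ) ^ p < m := by
    rw [hmdef]; push_cast; exact Nat.lt_floor_add_one _
  have hm_le : (m : ℝ) ≤ 2 * (S.card : ℝ) ^ p := by
    rw [hmdef]
    push_cast
    have := Nat.floor_le (show 0 ≤ (S.card : ℝ) ^ p by linarith)
    linarith
  have hL : 0 < Real.log (2 / δ) := Real.log_pos (by rw [lt_div_iff₀ hδ]; linarith)
  refine ⟨PrivateDist.release G S k m (ε / (16 * Real.sqrt (m * Real.log (2 / δ)))), inferInstance,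
    PrivateDist.isDP_release S k m (by omega) hε hε1 hδ hδ1, fun w => ?_⟩
  have hacc := PrivateDist.release_not_isAccurate_le S (m := m) hk
    (η := ε / (16 * Real.sqrt (m * Real.log (2 / δ)))) (t := 10 * Real.log (Fintype.card V))
    (c := (S.card : ℝ) ^ (1 / (k : ℝ))) (by positivity)
    (mul_nonneg (by norm_num) (Real.log_natCast_nonneg _)) (by positivity)
    (by rw [← Real.rpow_natCast, ← Real.rpow_mul (by positivity),
          one_div_mul_cancel (by positivity), Real.rpow_one])
    (by
      rw [hp, Real.rpow_add (by positivity), Real.rpow_one] at hm_gt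
      linarith) w
  have hfail := PrivateDist.failure_le hV hK hs S.card_le_univ hp2 hm_le
  have herr := PrivateDist.error_le hV hk hε hL.le hm_le
  refine le_trans (le_trans ?_ hacc) (measureReal_mono fun est h => h.mono herr)
  have : (0 : ℝ) ≤ 1 / Fintype.card V := by positivity
  rw [add_div]
  linarith
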